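/- Let $M=S^2\subset\mathbb R^3$ be the unit sphere with canonical metric $g_0$, area form $\omega$, area measure $d\mu$ and complex structure $J_0$ (rotation by $+90^\circ$, $J_0u=x\times u$ on $T_xS^2$), so $g_0(X,Y)=\omega(X,J_0Y)$. Let $\mathcal{AM}=\mathcal{AM}(S^2)$ be the space of associated metrics, i.e. the metrics $g(X,Y)=\omega(X,JY)$, where $J$ is a smooth almost complex structure with $\omega(JX,JY)=\omega(X,Y)$ and $\omega(X,JX)>0$ for $X\ne0$. Its tangent space $T_g\mathcal{AM}$ consists of the smooth symmetric 2-forms $h$ with $h(JX,JY)=-h(X,Y)$; it carries the operator $(\mathbf Jh)(X,Y)=h(X,JY)$ and the weak Riemannian structure $(a,b)_g=\int_M\mathrm{tr}(g^{-1}a\,g^{-1}b)\,d\mu$. Let $\mathrm{End}_{SJ_0}(TM)$ be the space of smooth $g_0$-symmetric endomorphisms of $TM$ anticommuting with $J_0$, and $\mathcal P_{J_0}$ the set of those $P$ in it for which $1-P^2$ is positive definite. The map $\Psi(P)=g_0(1+P)(1-P)^{-1}$, i.e. $\Psi(P)(X,Y)=g_0(X,(1+P)(1-P)^{-1}Y)$,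 is a bijection of $\mathcal P_{J_0}$ onto $\mathcal{AM}$; it serves as global chart, in which the Levi-Civita connection and the curvature of $\mathcal{AM}$ are computed. For $P\in\mathcal P_{J_0}$ and $g=\Psi(P)$ its differential $A\mapsto h_A=2g_0(1-P)^{-1}A(1-P)^{-1}$ is a bijection of $\mathrm{End}_{SJ_0}(TM)$ onto $T_g\mathcal{AM}$. Away from the poles let $z,\varphi$ be the height and the longitude, $e_1=(1-z^2)^{-1/2}\partial_\varphi$, $e_2=J_0e_1=(1-z^2)^{1/2}\partial_z$, $\partial=\frac12(e_1-ie_2)$, $\overline\partial=\frac12(e_1+ie_2)$. An operator $A\in\mathrm{End}_{SJ_0}(TM)$ is given by a complex function $\alpha$ on the sphere without poles: $A\partial=\alpha\overline\partial$, $A\overline\partial=\overline\alpha\,\partial$. **Theorem 8.1.** Let $P\in\mathcal P_{J_0}$ and $A,B\in\mathrm{End}_{SJ_0}(TM)$ be given by functions $p,\alpha,\beta$, and let $g=\Psi(P)$. If $h_A,h_B\in T_g\mathcal{AM}$ are linearly independent, then the sectional curvature $K_\sigma$ of $\mathcal{AM}$ at $g$ in the plane $\sigma$ spanned by $h_A,h_B$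 exists and is $$K_\sigma=-\frac12\,\frac{\displaystyle\int_M\frac{(\mathrm{Im}(\alpha\overline\beta))^2}{(1-|p|^2)^4}\,d\mu}{\displaystyle\int_M\frac{|\alpha|^2}{(1-|p|^2)^2}\,d\mu\ \int_M\frac{|\beta|^2}{(1-|p|^2)^2}\,d\mu-\Big(\int_M\frac{\mathrm{Re}(\overline\alpha\beta)}{(1-|p|^2)^2}\,d\mu\Big)^2}.$$ In particular: 1) If $\alpha,\beta$ are both real or both pure imaginary, then $K_\sigma=0$. 2) If one of $\alpha,\beta$ is real and the other is pure imaginary, then $$K_\sigma=-\frac12\,\frac{\displaystyle\int_M\frac{(\mathrm{Im}(\alpha\beta))^2}{(1-|p|^2)^4}\,d\mu}{\displaystyle\int_M\frac{|\alpha|^2}{(1-|p|^2)^2}\,d\mu\ \int_M\frac{|\beta|^2}{(1-|p|^2)^2}\,d\mu}.$$ 3) For every $A\neq0$ the holomorphic sectional curvature $K(h_A,\mathbf Jh_A)$ exists and satisfies $$K(h_A,\mathbf Jh_A)\le-\frac1{8\pi}.$$ -/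

import Mathlib

open MeasureTheory
open scoped Manifold ContDiff InnerProductSpace ComplexConjugate TensorProduct EuclideanSpace

noncomputable section

namespace SphereAM

/-! ### The unit sphere, its tangent planes and its tensor fields -/

/-- Euclidean three-space. -/
abbrev E3 : Type := EuclideanSpace ℝ (Fin 3)

/-- The unit sphere in Euclidean three-space, with Mathlib's manifold structure. -/
abbrev S2 : Type := Metric.sphere (0 : E3) 1

/-- The tangent plane of the sphere at `x`: the orthogonal complement of the line through `x`. -/
abbrev T (x : S2) : Submodule ℝ E3 := (ℝ ∙ (x : E3))ᗮ

/-- The orthogonal projection onto the tangent plane. -/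
def proj (x : S2) : E3 →L[ℝ] T x := (T x).orthogonalProjectionOnto

/-- (Not necessarily smooth) fields of endomorphisms of the tangent planes. -/
abbrev EndField : Type := ∀ x : S2, T x →L[ℝ] T x

/-- (Not necessarily smooth) fields of bilinear forms on the tangent planes. -/
abbrev FormField : Type := ∀ x : S2, T x →L[ℝ] T x →L[ℝ] ℝ

/-- Smoothness of a field of endomorphisms, tested on the tangential parts of constant vectors
(these span every tangent plane). -/
def IsSmoothEnd (A : EndField) : Prop :=
  ∀ v : E3, ContMDiff (𝓡 2) 𝓘(ℝ, E3) ∞ (fun x : S2 => ((A x (proj x v) : T x) : E3))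

/-- Smoothness of a field of bilinear forms. -/
def IsSmoothForm (h : FormField) : Prop :=
  ∀ u v : E3, ContMDiff (𝓡 2) 𝓘(ℝ, ℝ) ∞ (fun x : S2 => h x (proj x u) (proj x v))

/-- The area measure of the sphere (of total mass `4 * π`). -/
def area : Measure S2 := (volume : Measure E3).toSphere

/-- The cross product on Euclidean three-space. -/
def cross (u v : E3) : E3 := WithLp.toLp 2 (crossProduct (WithLp.ofLp u) (WithLp.ofLp v))

lemma cross_mem (x : S2) (v : E3) : cross (x : E3) v ∈ T x := by
  rw [Submodule.mem_orthogonal_singleton_iff_inner_right]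
  simp [cross, PiLp.inner_apply, cross_apply, Fin.sum_univ_three]
  ring

/-- The canonical complex structure of the sphere: rotation by a right angle in the tangent
plane, `u ↦ x × u` (`x` is the outer normal). -/
def J0 : EndField := fun x =>
  LinearMap.toContinuousLinearMap
    { toFun := fun u => ⟨cross (x : E3) (u : E3), cross_mem x u⟩
      map_add' := fun u v => by
        ext i; fin_cases i <;> simp [cross, cross_apply] <;> ring
      map_smul' := fun c u => by
        ext i; fin_cases i <;> simp [cross, cross_apply, mul_sub] }

/-- The symplectic form of the sphere, its area form: `ω (u, v) = det (x, u, v)`. -/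
def omega (x : S2) (u v : T x) : ℝ := ⟪cross (x : E3) (u : E3), (v : E3)⟫_ℝ

/-- The bilinear form `(u, v) ↦ g₀ (u, S v)`, where `g₀` is the canonical metric of the sphere. -/
def g0Form (x : S2) (S : T x →L[ℝ] T x) : T x →L[ℝ] T x →L[ℝ] ℝ :=
  (innerSL ℝ).bilinearComp (ContinuousLinearMap.id ℝ (T x)) S

/-! ### Associated almost complex structures and associated metrics -/

/-- `J` is a smooth almost complex structure which is positive associated with `ω`. -/
structure IsAssociatedACS (J : EndField) : Prop where
  smooth : IsSmoothEnd J
  sq : ∀ (x : S2) (u : T x), J x (J x u) = -u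
  invariant : ∀ (x : S2) (u v : T x), omega x (J x u) (J x v) = omega x u v
  pos : ∀ (x : S2) (u : T x), u ≠ 0 → 0 < omega x u (J x u)

/-- `g` is the metric defined by `J`: `g (u, v) = ω (u, J v)`. -/
def IsMetricOf (g : FormField) (J : EndField) : Prop :=
  ∀ (x : S2) (u v : T x), g x u v = omega x u (J x v)

/-- The space `𝓐𝓜(S²)` of associated metrics. -/
def AM : Set FormField := {g | ∃ J, IsAssociatedACS J ∧ IsMetricOf g J}

/-- The tangent space `T_g 𝓐𝓜(S²)`: smooth symmetric bilinear forms which are anti-Hermitian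
with respect to the almost complex structure of `g`. -/
def tangentAM (g : FormField) : Set FormField :=
  {h | IsSmoothForm h ∧ (∀ (x : S2) (u v : T x), h x u v = h x v u) ∧
    ∃ J, IsAssociatedACS J ∧ IsMetricOf g J ∧
      ∀ (x : S2) (u v : T x), h x (J x u) (J x v) = -h x u v}

/-- The operator `h ↦ h J`, `(h J) (u, v) = h (u, J v)`; for the almost complex structure `J` of
`g` it is the almost complex structure of `T_g 𝓐𝓜(S²)`. -/
def bigJ (J : EndField) (h : FormField) : FormField := fun x =>
  (h x).bilinearComp (ContinuousLinearMap.id ℝ (T x)) (J x)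

/-- The operator `g⁻¹ a` (raising of an index): `g (g⁻¹ a u, v) = a (u, v)`. -/
def raise (g a : FormField) : EndField := fun x => (g x).inverse ∘L (a x)

/-- The weak Riemannian structure `(a, b)_g = ∫ tr (g⁻¹ a g⁻¹ b) dμ`. -/
def weakInner (g a b : FormField) : ℝ :=
  ∫ x, LinearMap.trace ℝ (T x) ((raise g a x * raise g b x : T x →L[ℝ] T x) : T x →ₗ[ℝ] T x) ∂area

/-! ### The global parametrization -/

/-- The space of smooth endomorphisms which are symmetric with respect to the canonical metric and
anticommute with `J0`. -/
def endSJ0 : Submodule ℝ EndField where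
  carrier := {A | IsSmoothEnd A ∧ (∀ (x : S2) (u v : T x), ⟪A x u, v⟫_ℝ = ⟪u, A x v⟫_ℝ) ∧
    ∀ (x : S2) (u : T x), A x (J0 x u) = -J0 x (A x u)}
  add_mem' := by
    rintro A B ⟨hA, hA', hA''⟩ ⟨hB, hB', hB''⟩
    refine ⟨fun v => (hA v).add (hB v), fun x u v => ?_, fun x u => ?_⟩
    · simp only [Pi.add_apply, add_apply, inner_add_left, inner_add_right, hA', hB']
    · simp only [Pi.add_apply, add_apply, hA'', hB'', map_add, neg_add]
  zero_mem' := by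
    refine ⟨fun v => ?_, fun x u v => by simp, by simp⟩
    simpa using contMDiff_const
  smul_mem' := by
    rintro c A ⟨hA, hA', hA''⟩
    refine ⟨fun v => ?_, fun x u v => ?_, fun x u => ?_⟩
    · exact (c • ContinuousLinearMap.id ℝ E3).contMDiff.comp (hA v)
    · simp only [Pi.smul_apply, smul_apply, inner_smul_left, inner_smul_right, hA', conj_trivial]
    · simp only [Pi.smul_apply, smul_apply, hA'', map_smul, smul_neg]

/-- The domain of the parametrization: those `P` for which `1 - P²` is positive definite. -/
def paramDomain : Set EndField :=
  {P | P ∈ endSJ0 ∧ ∀ (x : S2) (u : T x), u ≠ 0 → 0 < ⟪u, (1 - P x * P x) u⟫_ℝ}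

/-- The global parametrization `P ↦ g₀ (1 + P) (1 - P)⁻¹` of the space of associated metrics. -/
def psi (P : EndField) : FormField := fun x => g0Form x ((1 + P x) * Ring.inverse (1 - P x))

/-- The differential of `psi` at `P` in the direction `A` (computed at each point of the sphere). -/
def dPsi (P A : EndField) : FormField := fun x => deriv (fun t : ℝ => psi (P + t • A) x) 0

/-- The form `h_A = 2 g₀ (1 - P)⁻¹ A (1 - P)⁻¹`. -/
def hForm (P A : EndField) : FormField := fun x =>
  (2 : ℝ) • g0Form x (Ring.inverse (1 - P x) * A x * Ring.inverse (1 - P x))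

/-! ### Levi-Civita connection and sectional curvature, in the global chart `psi` -/

/-- The weak Riemannian structure of `𝓐𝓜(S²)` in the chart `psi`, at the point `P`. -/
def chartMetric (P A B : EndField) : ℝ := weakInner (psi P) (dPsi P A) (dPsi P B)

/-- `Γ` is the Christoffel map of a Levi-Civita connection of the weak Riemannian structure:
the connection `∇_A B = d_A B + Γ_P (A, B)` is torsion free and metric. (`A`, `B`, `C` below are
constant vector fields in the chart.) -/
structure IsLeviCivita (Γ : EndField → endSJ0 →ₗ[ℝ] endSJ0 →ₗ[ℝ] endSJ0) : Prop where
  torsion_free : ∀ P ∈ paramDomain, ∀ A B : endSJ0, Γ P A B = Γ P B A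
  metric : ∀ P ∈ paramDomain, ∀ A B C : endSJ0,
    HasDerivAt (fun t : ℝ => chartMetric (P + t • (A : EndField)) B C)
      (chartMetric P (Γ P A B) C + chartMetric P B (Γ P A C)) 0

/-- `D` is the directional derivative at `P`, in the direction `A`, of the vector field `F` given
in the chart (derivatives of sections are computed at each point of the sphere). -/
def HasDirDeriv (F : EndField → endSJ0) (P : EndField) (A D : endSJ0) : Prop :=
  ∀ x : S2, HasDerivAt (fun t : ℝ => (F (P + t • (A : EndField)) : EndField) x)
    ((D : EndField) x) 0

/-- `R` is the value `R (A, B) C = ∇_A ∇_B C - ∇_B ∇_A C` at `P` of the curvature tensor of the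
connection with Christoffel map `Γ` (`A`, `B`, `C` are constant vector fields in the chart). -/
def IsCurvature (Γ : EndField → endSJ0 →ₗ[ℝ] endSJ0 →ₗ[ℝ] endSJ0) (P : EndField)
    (A B C R : endSJ0) : Prop :=
  ∃ D₁ D₂ : endSJ0, HasDirDeriv (fun Q => Γ Q B C) P A D₁ ∧ HasDirDeriv (fun Q => Γ Q A C) P B D₂ ∧
    R = (D₁ + Γ P A (Γ P B C)) - (D₂ + Γ P B (Γ P A C))

/-- `K` is the sectional curvature of `𝓐𝓜(S²)`, with its weak Riemannian structure, at the metric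
`g` in the plane spanned by the linearly independent tangent elements `h` and `k`:
`K = (R (h, k) k, h) / (‖h‖² ‖k‖² - (h, k)²)`. -/
def HasSectionalCurvature (g h k : FormField) (K : ℝ) : Prop :=
  g ∈ AM ∧ h ∈ tangentAM g ∧ k ∈ tangentAM g ∧ LinearIndependent ℝ ![h, k] ∧
    ∃ P ∈ paramDomain, ∃ A B : endSJ0, psi P = g ∧ dPsi P A = h ∧ dPsi P B = k ∧
      ∃ Γ, IsLeviCivita Γ ∧ ∃ R : endSJ0, IsCurvature Γ P A B B R ∧
        K = weakInner g (dPsi P R) h /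
          (weakInner g h h * weakInner g k k - weakInner g h k ^ 2)

/-! ### The complex frame -/

/-- The sphere without its poles; here `z ∈ (-1, 1)`. -/
def offPoles : Set S2 := {x | |(x : E3) 2| < 1}

lemma east_mem (x : S2) :
    (√((x : E3) 0 ^ 2 + (x : E3) 1 ^ 2))⁻¹ • (!₂[-(x : E3) 1, (x : E3) 0, 0] : E3) ∈ T x := by
  apply Submodule.smul_mem
  rw [Submodule.mem_orthogonal_singleton_iff_inner_right]
  simp [PiLp.inner_apply, Fin.sum_univ_three]
  ring

/-- The unit vector field `e₁ = (1 - z²)^(-1/2) ∂/∂φ` (away from the poles). -/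
def e1 (x : S2) : T x := ⟨_, east_mem x⟩

/-- The unit vector field `e₂ = J₀ e₁ = (1 - z²)^(1/2) ∂/∂z` (away from the poles). -/
def e2 (x : S2) : T x := J0 x (e1 x)

/-- The complex tangent vector `∂ = (e₁ - i e₂) / 2`. -/
def del (x : S2) : ℂ ⊗[ℝ] T x := (1 / 2 : ℂ) • (1 ⊗ₜ[ℝ] e1 x - Complex.I ⊗ₜ[ℝ] e2 x)

/-- The complex tangent vector `∂̄ = (e₁ + i e₂) / 2`. -/
def delBar (x : S2) : ℂ ⊗[ℝ] T x := (1 / 2 : ℂ) • (1 ⊗ₜ[ℝ] e1 x + Complex.I ⊗ₜ[ℝ] e2 x)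

/-- The operator `A` is given by the complex function `α`: away from the poles it has, in the
complex frame `∂, ∂̄`, the matrix with rows `(0, conj α)` and `(α, 0)`. -/
def IsGivenBy (A : EndField) (α : S2 → ℂ) : Prop :=
  ∀ x ∈ offPoles,
    ((A x : T x →ₗ[ℝ] T x).baseChange ℂ) (del x) = α x • delBar x ∧
    ((A x : T x →ₗ[ℝ] T x).baseChange ℂ) (delBar x) = conj (α x) • del x

/-- The function is real (where the complex frame is defined). -/
def IsRealFun (α : S2 → ℂ) : Prop := ∀ x ∈ offPoles, (α x).im = 0

/-- The function is pure imaginary (where the complex frame is defined). -/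
def IsImagFun (α : S2 → ℂ) : Prop := ∀ x ∈ offPoles, (α x).re = 0

end SphereAM

end

open SphereAM

open MeasureTheory
open scoped Manifold ContDiff InnerProductSpace ComplexConjugate TensorProduct EuclideanSpace

noncomputable section

namespace SphereAM

section

/-! ### The tangent planes -/

/-! The space of associated metrics is an integral over the sphere of Poincaré discs, and all the
geometry is pointwise. On a tangent plane every real endomorphism is uniquely u ↦ wu + z·ū in a
complex coordinate, with w, z complex; `ca x w z` denotes it, and `ca_mul` gives the product.
Symmetric endomorphisms anticommuting with `J0` are those with w = 0, so P, A, B become complex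
factors p, a, b (`co`), and the condition on P says |p| < 1.

In these coordinates the weak metric in the chart is ∫ 8 Re(a b̄)/(1-|p|²)² dμ (`trace_raise`,
`chartMetric_eq`): twice the hyperbolic metric 4|dp|²/(1-|p|²)² of curvature -1, integrated over the
sphere. Hence the Christoffel map is the pointwise one, 2ab p̄/(1-|p|²). It is metric by
differentiation under the integral (`hasDerivAt_chartMetric`, `dens_gam`), and it is the only one
because the weak metric is definite (`IsLeviCivita.eq_gam`). The curvature is then pointwise as
well: R(A,B)B has factor 2b(b ā - a b̄)/(1-|p|²)² (`curvature_identity`). Pairing with A gives -32 ∫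
Im(a b̄)²/(1-|p|²)⁴, while the Gram determinant carries 8² = 64; this is the factor -1/2.

The functions in the complex frame are the conjugates of the factors a, b, p (`IsGivenBy.eq`), which
changes none of the integrands, and the poles are a null set. The operator **J** multiplies a by -i
(`bigJ_hForm`), so the holomorphic curvature is -½ ∫f²/(∫f)² with f = |a|²/(1-|p|²)², and
Cauchy–Schwarz on a sphere of area 4π bounds it.

No unit tangent field is continuous on the whole sphere, so the factors themselves need not be
continuous. Smoothness is therefore always derived from frame-independent expressions: products of
operators and their traces. -/

lemma sum_sq (x : S2) : (x : E3) 0 ^ 2 + (x : E3) 1 ^ 2 + (x : E3) 2 ^ 2 = 1 := by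
  have h : ‖(x : E3)‖ = 1 := by simp
  rw [EuclideanSpace.norm_eq, Real.sqrt_eq_one, Fin.sum_univ_three] at h
  simpa using h

lemma tangent_sum (x : S2) (u : T x) :
    (x : E3) 0 * (u : E3) 0 + (x : E3) 1 * (u : E3) 1 + (x : E3) 2 * (u : E3) 2 = 0 := by
  have h := (Submodule.mem_orthogonal_singleton_iff_inner_right).1 u.2
  rw [PiLp.inner_apply, Fin.sum_univ_three] at h
  simp only [RCLike.inner_apply, conj_trivial] at h
  linear_combination h

lemma inner_coord (x : S2) (u v : T x) :
    ⟪u, v⟫_ℝ = (u : E3) 0 * (v : E3) 0 + (u : E3) 1 * (v : E3) 1 + (u : E3) 2 * (v : E3) 2 := by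
  rw [Submodule.coe_inner, PiLp.inner_apply, Fin.sum_univ_three]
  simp only [RCLike.inner_apply, conj_trivial]
  ring

lemma coe_J0 (x : S2) (u : T x) : ((J0 x u : T x) : E3) = cross (x : E3) (u : E3) := rfl

lemma cross_zero (u v : E3) : cross u v 0 = u 1 * v 2 - u 2 * v 1 := by
  simp [cross, cross_apply]

lemma cross_one (u v : E3) : cross u v 1 = u 2 * v 0 - u 0 * v 2 := by
  simp [cross, cross_apply]

lemma cross_two (u v : E3) : cross u v 2 = u 0 * v 1 - u 1 * v 0 := by
  simp [cross, cross_apply]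

lemma J0_J0_apply (x : S2) (u : T x) : J0 x (J0 x u) = -u := by
  have h1 := sum_sq x
  have h2 := tangent_sum x u
  ext i
  fin_cases i
  · simp only [coe_J0, Fin.zero_eta, cross_zero, cross_one, cross_two, Submodule.coe_neg,
      PiLp.neg_apply]
    linear_combination (x : E3) 0 * h2 - (u : E3) 0 * h1
  · simp only [coe_J0, Fin.mk_one, cross_zero, cross_one, cross_two, Submodule.coe_neg,
      PiLp.neg_apply]
    linear_combination (x : E3) 1 * h2 - (u : E3) 1 * h1
  · simp only [coe_J0, Fin.reduceFinMk, cross_zero, cross_one, cross_two, Submodule.coe_neg,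
      PiLp.neg_apply]
    linear_combination (x : E3) 2 * h2 - (u : E3) 2 * h1

lemma inner_J0_left (x : S2) (u v : T x) : ⟪J0 x u, v⟫_ℝ = -⟪u, J0 x v⟫_ℝ := by
  simp only [inner_coord, coe_J0, cross_zero, cross_one, cross_two]
  ring

lemma inner_J0_self (x : S2) (u : T x) : ⟪u, J0 x u⟫_ℝ = 0 := by
  simp only [inner_coord, coe_J0, cross_zero, cross_one, cross_two]
  ring

lemma inner_J0_J0 (x : S2) (u v : T x) : ⟪J0 x u, J0 x v⟫_ℝ = ⟪u, v⟫_ℝ := by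
  rw [inner_J0_left, J0_J0_apply, inner_neg_right, neg_neg]

lemma omega_eq (x : S2) (u v : T x) : omega x u v = ⟪J0 x u, v⟫_ℝ := rfl

lemma finrank_T (x : S2) : Module.finrank ℝ (T x) = 2 := by
  have : Fact (Module.finrank ℝ E3 = 2 + 1) := ⟨by simp⟩
  have hx : (x : E3) ≠ 0 := by
    intro h
    have : ‖(x : E3)‖ = 1 := by simp
    rw [h] at this; simp at this
  exact Submodule.finrank_orthogonal_span_singleton hx

/-! ### The frame and the algebra of endomorphisms of a tangent plane -/

lemma inner_e1_self {x : S2} (hx : x ∈ offPoles) : ⟪e1 x, e1 x⟫_ℝ = 1 := by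
  have h1 := sum_sq x
  have h2 : (x : E3) 2 ^ 2 < 1 := (sq_lt_one_iff_abs_lt_one _).2 hx
  have h3 : 0 < (x : E3) 0 ^ 2 + (x : E3) 1 ^ 2 := by linarith
  rw [inner_coord]
  simp only [e1, PiLp.smul_apply, smul_eq_mul]
  simp only [Matrix.cons_val_zero, Matrix.cons_val_one, Matrix.cons_val]
  have h4 := Real.sq_sqrt h3.le
  have h5 := (Real.sqrt_pos.2 h3).ne'
  field_simp
  linear_combination -h4

/-- At the poles `e1` is the zero vector, so an arbitrary unit vector replaces it there. This gives
coordinates at every point, at the price of continuity. -/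
lemma exists_unit (x : S2) : ∃ f : T x, ⟪f, f⟫_ℝ = 1 ∧ (x ∈ offPoles → f = e1 x) := by
  by_cases hx : x ∈ offPoles
  · exact ⟨e1 x, inner_e1_self hx, fun _ => rfl⟩
  · have : Nontrivial (T x) := Module.nontrivial_of_finrank_pos (R := ℝ) (by rw [finrank_T]; norm_num)
    obtain ⟨f, hf⟩ := exists_norm_eq (T x) zero_le_one
    exact ⟨f, by rw [real_inner_self_eq_norm_sq, hf, one_pow], fun h => absurd h hx⟩

/-- A unit tangent vector, which is `e1` away from the poles. -/
def frame (x : S2) : T x := (exists_unit x).choose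

lemma inner_frame_self (x : S2) : ⟪frame x, frame x⟫_ℝ = 1 := (exists_unit x).choose_spec.1

lemma frame_eq {x : S2} (hx : x ∈ offPoles) : frame x = e1 x := (exists_unit x).choose_spec.2 hx

lemma orthonormal_frame (x : S2) : Orthonormal ℝ ![frame x, J0 x (frame x)] := by
  rw [orthonormal_iff_ite]
  intro i j
  have h1 := inner_frame_self x
  have h2 := inner_J0_self x (frame x)
  have h3 : ⟪J0 x (frame x), frame x⟫_ℝ = 0 := by rw [real_inner_comm, h2]
  have h4 := inner_J0_J0 x (frame x) (frame x)
  fin_cases i <;> fin_cases j <;> simp_all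

/-- The orthonormal basis given by the frame and its image under the rotation. -/
def onb (x : S2) : OrthonormalBasis (Fin 2) ℝ (T x) :=
  OrthonormalBasis.mk (orthonormal_frame x) (by
    have h := (orthonormal_frame x).linearIndependent.span_eq_top_of_card_eq_finrank
      (by rw [finrank_T]; rfl)
    exact h.ge)

lemma onb_zero (x : S2) : onb x 0 = frame x := by simp [onb]

lemma onb_one (x : S2) : onb x 1 = J0 x (frame x) := by simp [onb]

lemma eq_frame_sum (x : S2) (u : T x) :
    u = ⟪frame x, u⟫_ℝ • frame x + ⟪J0 x (frame x), u⟫_ℝ • J0 x (frame x) := by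
  have h := (onb x).sum_repr' u
  rw [Fin.sum_univ_two, onb_zero, onb_one] at h
  exact h.symm

/-- Endomorphisms of a tangent plane. -/
abbrev EndT (x : S2) : Type := T x →L[ℝ] T x

lemma end_ext {x : S2} {L M : EndT x} (h1 : L (frame x) = M (frame x))
    (h2 : L (J0 x (frame x)) = M (J0 x (frame x))) : L = M := by
  ext1 u
  rw [eq_frame_sum x u, map_add, map_smul, map_smul, h1, h2, map_add, map_smul, map_smul]

lemma J0_mul_J0 (x : S2) : J0 x * J0 x = -1 := by
  ext1 u
  exact J0_J0_apply x u

/-- The reflection of the tangent plane fixing the frame vector. -/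
def kap (x : S2) : EndT x :=
  (2 : ℝ) • ((innerSL ℝ (frame x)).smulRight (frame x)) - 1

lemma kap_apply (x : S2) (u : T x) : kap x u = (2 * ⟪frame x, u⟫_ℝ) • frame x - u := by
  simp [kap, mul_smul]

lemma kap_frame (x : S2) : kap x (frame x) = frame x := by
  rw [kap_apply, inner_frame_self, mul_one, two_smul, add_sub_cancel_right]

lemma kap_J0_frame (x : S2) : kap x (J0 x (frame x)) = -J0 x (frame x) := by
  rw [kap_apply, inner_J0_self, mul_zero, zero_smul, zero_sub]

lemma kap_mul_kap (x : S2) : kap x * kap x = 1 := by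
  apply end_ext <;> simp [kap_frame, kap_J0_frame]

lemma kap_mul_J0 (x : S2) : kap x * J0 x = -(J0 x * kap x) := by
  apply end_ext <;> simp [kap_frame, kap_J0_frame, J0_J0_apply]

lemma inner_kap_left (x : S2) (u v : T x) : ⟪kap x u, v⟫_ℝ = ⟪u, kap x v⟫_ℝ := by
  simp only [kap_apply, inner_sub_left, inner_sub_right, inner_smul_left, inner_smul_right,
    conj_trivial, real_inner_comm u (frame x)]
  ring

/-- The conformal endomorphism with complex factor `w`. -/
def conf (x : S2) (w : ℂ) : EndT x := w.re • (1 : EndT x) + w.im • J0 x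

/-- The anticonformal endomorphism with complex factor `z`. -/
def anti (x : S2) (z : ℂ) : EndT x := conf x z * kap x

variable {x : S2}

/-! ### Multiplication rules and traces of conformal and anticonformal endomorphisms. -/

lemma conf_apply (w : ℂ) (u : T x) : conf x w u = w.re • u + w.im • J0 x u := rfl

lemma conf_add (w z : ℂ) : conf x (w + z) = conf x w + conf x z := by
  ext1 u
  simp only [add_apply, conf_apply, Complex.add_re, Complex.add_im]
  module

lemma anti_add (w z : ℂ) : anti x (w + z) = anti x w + anti x z := by
  rw [anti, conf_add, add_mul]; rfl

lemma conf_neg (w : ℂ) : conf x (-w) = -conf x w := by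
  ext1 u
  simp only [neg_apply, conf_apply, Complex.neg_re, Complex.neg_im]
  module

lemma anti_neg (w : ℂ) : anti x (-w) = -anti x w := by
  ext1 u
  simp only [anti, mul_apply_eq_comp, conf_neg, neg_apply]

lemma conf_sub (w z : ℂ) : conf x (w - z) = conf x w - conf x z := by
  rw [sub_eq_add_neg, conf_add, conf_neg, sub_eq_add_neg]

lemma anti_sub (w z : ℂ) : anti x (w - z) = anti x w - anti x z := by
  rw [sub_eq_add_neg, anti_add, anti_neg, sub_eq_add_neg]

lemma conf_one : conf x 1 = 1 := by
  ext1 u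
  simp [conf_apply]

lemma conf_I : conf x Complex.I = J0 x := by
  ext1 u
  simp [conf_apply]

lemma conf_zero : conf x 0 = 0 := by
  ext1 u
  simp [conf_apply]

lemma anti_zero : anti x 0 = 0 := by
  ext1 u
  simp [anti, conf_zero]

lemma conf_ofReal_mul (r : ℝ) (L : EndT x) : conf x r * L = r • L := by
  ext1 u
  simp [conf_apply]

lemma conf_mul_conf (w z : ℂ) : conf x w * conf x z = conf x (w * z) := by
  ext1 u
  simp only [mul_apply_eq_comp, conf_apply, Complex.mul_re, Complex.mul_im, map_add, map_smul,
    J0_J0_apply]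
  module

lemma kap_mul_conf (w : ℂ) : kap x * conf x w = conf x (conj w) * kap x := by
  have h : ∀ u, kap x (J0 x u) = -J0 x (kap x u) := fun u =>
    congrArg (fun L : EndT x => L u) (kap_mul_J0 x)
  ext1 u
  simp only [mul_apply_eq_comp, conf_apply, Complex.conj_re, Complex.conj_im, map_add, map_smul, h]
  module

lemma conf_mul_anti (w z : ℂ) : conf x w * anti x z = anti x (w * z) := by
  rw [anti, ← mul_assoc, conf_mul_conf, anti]

lemma anti_mul_conf (z w : ℂ) : anti x z * conf x w = anti x (z * conj w) := by
  rw [anti, mul_assoc, kap_mul_conf, ← mul_assoc, conf_mul_conf, anti]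

lemma anti_mul_anti (w z : ℂ) : anti x w * anti x z = conf x (w * conj z) := by
  rw [anti, anti, mul_assoc, ← mul_assoc (kap x), kap_mul_conf, mul_assoc (conf x _), kap_mul_kap,
    mul_one, conf_mul_conf]

lemma conf_frame (w : ℂ) : conf x w (frame x) = w.re • frame x + w.im • J0 x (frame x) := by
  simp [conf]

lemma anti_frame (w : ℂ) : anti x w (frame x) = w.re • frame x + w.im • J0 x (frame x) := by
  simp [anti, conf, kap_frame]

lemma conf_J0_frame (w : ℂ) :
    conf x w (J0 x (frame x)) = (-w.im) • frame x + w.re • J0 x (frame x) := by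
  simp [conf, J0_J0_apply]; abel

lemma anti_J0_frame (w : ℂ) :
    anti x w (J0 x (frame x)) = w.im • frame x - w.re • J0 x (frame x) := by
  simp [anti, conf, kap_J0_frame, J0_J0_apply]; abel

lemma inner_J0_frame_frame : ⟪J0 x (frame x), frame x⟫_ℝ = 0 := by
  rw [real_inner_comm, inner_J0_self]

lemma inner_J0_frame_self : ⟪J0 x (frame x), J0 x (frame x)⟫_ℝ = 1 := by
  rw [inner_J0_J0, inner_frame_self]

lemma trace_eq (L : EndT x) : LinearMap.trace ℝ (T x) (L : T x →ₗ[ℝ] T x) =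
    ⟪frame x, L (frame x)⟫_ℝ + ⟪J0 x (frame x), L (J0 x (frame x))⟫_ℝ := by
  rw [LinearMap.trace_eq_sum_inner _ (onb x), Fin.sum_univ_two, onb_zero, onb_one]
  rfl

lemma trace_conf (w : ℂ) :
    LinearMap.trace ℝ (T x) ((conf x w : EndT x) : T x →ₗ[ℝ] T x) = 2 * w.re := by
  simp only [trace_eq, conf_frame, conf_J0_frame, inner_add_right, inner_smul_right,
    inner_frame_self, inner_J0_self, inner_J0_frame_frame, inner_J0_frame_self]
  ring

lemma trace_anti (w : ℂ) :
    LinearMap.trace ℝ (T x) ((anti x w : EndT x) : T x →ₗ[ℝ] T x) = 0 := by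
  simp only [trace_eq, anti_frame, anti_J0_frame, inner_add_right, inner_sub_right,
    inner_smul_right, inner_frame_self, inner_J0_self, inner_J0_frame_frame, inner_J0_frame_self]
  ring

/-- The complex factor of the conformal part of an endomorphism. -/
def cconf (L : EndT x) : ℂ :=
  ⟨(⟪frame x, L (frame x)⟫_ℝ + ⟪J0 x (frame x), L (J0 x (frame x))⟫_ℝ) / 2,
    (⟪J0 x (frame x), L (frame x)⟫_ℝ - ⟪frame x, L (J0 x (frame x))⟫_ℝ) / 2⟩

/-- The complex factor of the anticonformal part of an endomorphism. -/
def canti (L : EndT x) : ℂ :=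
  ⟨(⟪frame x, L (frame x)⟫_ℝ - ⟪J0 x (frame x), L (J0 x (frame x))⟫_ℝ) / 2,
    (⟪J0 x (frame x), L (frame x)⟫_ℝ + ⟪frame x, L (J0 x (frame x))⟫_ℝ) / 2⟩

lemma eq_conf_add_anti (L : EndT x) : L = conf x (cconf L) + anti x (canti L) := by
  apply end_ext
  · rw [eq_frame_sum x (L (frame x)), add_apply, conf_frame, anti_frame]
    simp only [cconf, canti]
    module
  · rw [eq_frame_sum x (L (J0 x (frame x))), add_apply, conf_J0_frame, anti_J0_frame]
    simp only [cconf, canti]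
    module

lemma cconf_conf_add_anti (w z : ℂ) : cconf (conf x w + anti x z) = w := by
  apply Complex.ext <;>
  · simp only [cconf, add_apply, conf_frame, anti_frame, conf_J0_frame, anti_J0_frame,
      inner_add_right, inner_sub_right, inner_smul_right, inner_frame_self, inner_J0_self,
      inner_J0_frame_frame, inner_J0_frame_self]
    ring

lemma canti_conf_add_anti (w z : ℂ) : canti (conf x w + anti x z) = z := by
  apply Complex.ext <;>
  · simp only [canti, add_apply, conf_frame, anti_frame, conf_J0_frame, anti_J0_frame,
      inner_add_right, inner_sub_right, inner_smul_right, inner_frame_self, inner_J0_self,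
      inner_J0_frame_frame, inner_J0_frame_self]
    ring

lemma canti_anti (z : ℂ) : canti (anti x z) = z := by
  simpa [conf_zero] using canti_conf_add_anti (x := x) 0 z

lemma conf_add_anti_inj {w z w' z' : ℂ} (h : conf x w + anti x z = conf x w' + anti x z') :
    w = w' ∧ z = z' := by
  have h1 := congrArg cconf h
  have h2 := congrArg canti h
  rw [cconf_conf_add_anti, cconf_conf_add_anti] at h1
  rw [canti_conf_add_anti, canti_conf_add_anti] at h2
  exact ⟨h1, h2⟩

lemma inner_conf_left (w : ℂ) (u v : T x) : ⟪conf x w u, v⟫_ℝ = ⟪u, conf x (conj w) v⟫_ℝ := by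
  simp only [conf, add_apply, smul_apply, inner_add_left, inner_add_right, inner_smul_left,
    inner_smul_right, inner_J0_left, Complex.conj_re, Complex.conj_im, conj_trivial,
    one_apply_eq_self]
  ring

lemma inner_anti_left (z : ℂ) (u v : T x) : ⟪anti x z u, v⟫_ℝ = ⟪u, anti x z v⟫_ℝ := by
  have h : kap x * conf x (conj z) = anti x z := by rw [kap_mul_conf, Complex.conj_conj, anti]
  conv_rhs => rw [← h]
  rw [anti, mul_apply_eq_comp, mul_apply_eq_comp, inner_conf_left, inner_kap_left]

/-- An endomorphism anticommuting with the rotation is anticonformal. -/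
lemma eq_anti {L : EndT x} (h : ∀ u, L (J0 x u) = -J0 x (L u)) : L = anti x (canti L) := by
  have h1 : L * J0 x = -(J0 x * L) := by ext1 u; exact h u
  rw [eq_conf_add_anti L, ← conf_I, add_mul, mul_add, conf_mul_conf, conf_mul_conf,
    anti_mul_conf, conf_mul_anti, neg_add, ← conf_neg, ← anti_neg] at h1
  have h2 := (conf_add_anti_inj h1).1
  have h3 : cconf L = 0 := by
    have : 2 * (cconf L * Complex.I) = 0 := by linear_combination h2
    simpa using this
  conv_lhs => rw [eq_conf_add_anti L, h3, conf_zero, zero_add]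

/-- A symmetric endomorphism has real conformal factor. -/
lemma cconf_im_eq_zero {L : EndT x} (h : ∀ u v, ⟪L u, v⟫_ℝ = ⟪u, L v⟫_ℝ) : (cconf L).im = 0 := by
  simp only [cconf]
  rw [real_inner_comm, h, sub_self, zero_div]

lemma anti_J0 (z : ℂ) (u : T x) : anti x z (J0 x u) = -J0 x (anti x z u) := by
  have h : anti x z * J0 x = -(J0 x * anti x z) := by
    rw [← conf_I, anti_mul_conf, conf_mul_anti, ← anti_neg]
    congr 1
    simp [mul_comm]
  exact congrArg (fun L : EndT x => L u) h

end

/-! ### Smooth fields -/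

/-- Smooth real functions on the sphere. -/
abbrev SmoothFun (s : S2 → ℝ) : Prop := ContMDiff (𝓡 2) 𝓘(ℝ, ℝ) ∞ s

/-- Smooth vector functions on the sphere. -/
abbrev SmoothVec (w : S2 → E3) : Prop := ContMDiff (𝓡 2) 𝓘(ℝ, E3) ∞ w

lemma smoothVec_coe : SmoothVec (fun x : S2 => (x : E3)) := contMDiff_coe_sphere

lemma SmoothVec.inner {v w : S2 → E3} (hv : SmoothVec v) (hw : SmoothVec w) :
    SmoothFun (fun x => ⟪v x, w x⟫_ℝ) :=
  (contDiff_inner (𝕜 := ℝ) (E := E3) (n := ∞)).contMDiff.comp (hv.prodMk_space hw)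

lemma SmoothVec.clm {v : S2 → E3} (L : E3 →L[ℝ] E3) (hv : SmoothVec v) :
    SmoothVec (fun x => L (v x)) :=
  L.contMDiff.comp hv

/-- The standard basis of Euclidean space. -/
abbrev stdb : OrthonormalBasis (Fin 3) ℝ E3 := EuclideanSpace.basisFun (Fin 3) ℝ

lemma smoothVec_of_inner {w : S2 → E3} (h : ∀ u, SmoothFun (fun x => ⟪u, w x⟫_ℝ)) :
    SmoothVec w := by
  have : w = fun x => ∑ i, ⟪stdb i, w x⟫_ℝ • stdb i := by
    funext x
    exact (stdb.sum_repr' (w x)).symm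
  rw [this]
  exact ContMDiff.sum fun i _ => (h (stdb i)).smul contMDiff_const

lemma smoothVec_sum {ι : Type} [Fintype ι] {c : ι → S2 → ℝ} {w : ι → S2 → E3}
    (hc : ∀ i, SmoothFun (c i)) (hw : ∀ i, SmoothVec (w i)) :
    SmoothVec (fun x => ∑ i, c i x • w i x) :=
  ContMDiff.sum fun i _ => (hc i).smul (hw i)

lemma proj_coe (x : S2) (u : T x) : proj x (u : E3) = u :=
  Submodule.orthogonalProjectionOnto_mem_subspace_eq_self u

lemma inner_proj_right (x : S2) (u : T x) (v : E3) : ⟪u, proj x v⟫_ℝ = ⟪(u : E3), v⟫_ℝ := by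
  have := Submodule.inner_orthogonalProjectionOnto_eq_of_mem_left (K := T x) u v
  exact this

lemma inner_proj_left (x : S2) (u : T x) (v : E3) : ⟪proj x v, u⟫_ℝ = ⟪v, (u : E3)⟫_ℝ := by
  rw [real_inner_comm, inner_proj_right, real_inner_comm]

lemma coe_proj (x : S2) (v : E3) : ((proj x v : T x) : E3) = v - ⟪(x : E3), v⟫_ℝ • (x : E3) := by
  have hx : ‖(x : E3)‖ = 1 := by simp
  have h : v - ⟪(x : E3), v⟫_ℝ • (x : E3) ∈ T x := by
    rw [Submodule.mem_orthogonal_singleton_iff_inner_right, inner_sub_right, inner_smul_right,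
      real_inner_self_eq_norm_sq, hx]
    ring
  have h2 : v = ((⟨_, h⟩ : T x) : E3) + ⟪(x : E3), v⟫_ℝ • (x : E3) := by simp
  have h3 : proj x (x : E3) = 0 := by
    refine ext_inner_left ℝ fun u => ?_
    rw [inner_proj_right, inner_zero_right, real_inner_comm]
    exact (Submodule.mem_orthogonal_singleton_iff_inner_right).1 u.2
  conv_lhs => rw [h2, map_add, map_smul, h3, smul_zero, add_zero, proj_coe]

/-- Expanding `w` in the constant standard basis and projecting turns A w into a combination of the
test fields with smooth coefficients. Smoothness of products of operators rests on this. -/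
lemma IsSmoothEnd.apply {A : EndField} (hA : IsSmoothEnd A) {w : ∀ x, T x}
    (hw : SmoothVec (fun x => (w x : E3))) : SmoothVec (fun x => ((A x (w x) : T x) : E3)) := by
  have : (fun x => ((A x (w x) : T x) : E3)) =
      fun x => ∑ i, ⟪stdb i, (w x : E3)⟫_ℝ • ((A x (proj x (stdb i)) : T x) : E3) := by
    funext x
    conv_lhs => rw [← proj_coe x (w x), ← stdb.sum_repr' (w x : E3)]
    simp only [map_sum, map_smul, Submodule.coe_sum, Submodule.coe_smul]
  rw [this]
  exact smoothVec_sum (fun i => SmoothVec.inner contMDiff_const hw) fun i => hA (stdb i)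

lemma smoothVec_proj (v : E3) : SmoothVec (fun x => ((proj x v : T x) : E3)) := by
  simp only [coe_proj]
  exact contMDiff_const.sub ((smoothVec_coe.inner contMDiff_const).smul smoothVec_coe)

lemma IsSmoothEnd.mul {A B : EndField} (hA : IsSmoothEnd A) (hB : IsSmoothEnd B) :
    IsSmoothEnd (fun x => A x * B x) := fun v =>
  hA.apply (w := fun x => B x (proj x v)) (hB v)

lemma IsSmoothEnd.add {A B : EndField} (hA : IsSmoothEnd A) (hB : IsSmoothEnd B) :
    IsSmoothEnd (fun x => A x + B x) := fun v => ContMDiff.add (hA v) (hB v)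

lemma IsSmoothEnd.sub {A B : EndField} (hA : IsSmoothEnd A) (hB : IsSmoothEnd B) :
    IsSmoothEnd (fun x => A x - B x) := fun v => ContMDiff.sub (hA v) (hB v)

lemma IsSmoothEnd.neg {A : EndField} (hA : IsSmoothEnd A) :
    IsSmoothEnd (fun x => -A x) := fun v => ContMDiff.neg (hA v)

lemma IsSmoothEnd.smul {A : EndField} {s : S2 → ℝ} (hs : SmoothFun s) (hA : IsSmoothEnd A) :
    IsSmoothEnd (fun x => s x • A x) := fun v => ContMDiff.smul hs (hA v)

lemma isSmoothEnd_one : IsSmoothEnd (fun _ => 1) := fun v => smoothVec_proj v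

lemma isSmoothEnd_J0 : IsSmoothEnd J0 := by
  intro v
  let L : E3 →L[ℝ] E3 := LinearMap.toContinuousLinearMap
    { toFun := fun u => cross u v
      map_add' := fun u w => by ext i; fin_cases i <;> simp [cross, cross_apply]
      map_smul' := fun c u => by ext i; fin_cases i <;> simp [cross, cross_apply, mul_sub] }
  have : (fun x : S2 => ((J0 x (proj x v) : T x) : E3)) = fun x : S2 => L x := by
    funext x
    rw [coe_J0, coe_proj]
    change _ = cross x v
    ext i
    fin_cases i <;> simp [cross, cross_apply] <;> ring
  rw [this]
  exact smoothVec_coe.clm L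

/-- By cyclicity of the trace, L has the same trace as its extension L ∘ `proj` to the ambient
space. There a constant basis is available, so the dependence on x is visibly smooth. -/
lemma trace_eq_sum (x : S2) (L : EndT x) :
    LinearMap.trace ℝ (T x) (L : T x →ₗ[ℝ] T x) =
      ∑ i, ⟪stdb i, ((L (proj x (stdb i)) : T x) : E3)⟫_ℝ := by
  have h := LinearMap.trace_comp_comm' ((T x).subtype ∘ₗ (L : T x →ₗ[ℝ] T x))
    (proj x : E3 →ₗ[ℝ] T x)
  have h2 : (proj x : E3 →ₗ[ℝ] T x) ∘ₗ ((T x).subtype ∘ₗ (L : T x →ₗ[ℝ] T x)) = L := by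
    ext1 u
    exact proj_coe x (L u)
  rw [h2] at h
  rw [h, LinearMap.trace_eq_sum_inner _ stdb]
  rfl

lemma IsSmoothEnd.trace {A : EndField} (hA : IsSmoothEnd A) :
    SmoothFun (fun x => LinearMap.trace ℝ (T x) (A x : T x →ₗ[ℝ] T x)) := by
  simp only [trace_eq_sum]
  exact ContMDiff.sum fun i _ => SmoothVec.inner contMDiff_const (hA _)

lemma g0Form_apply (x : S2) (S : EndT x) (u v : T x) : g0Form x S u v = ⟪u, S v⟫_ℝ := rfl

lemma isSmoothForm_g0Form {S : EndField} :
    IsSmoothForm (fun x => g0Form x (S x)) ↔ IsSmoothEnd S := by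
  constructor
  · intro h v
    refine smoothVec_of_inner fun u => ?_
    simp only [← inner_proj_left]
    exact h u v
  · intro h u v
    simp only [g0Form_apply, inner_proj_left]
    exact SmoothVec.inner contMDiff_const (h v)

lemma g0Form_injective {x : S2} {S S' : EndT x} (h : g0Form x S = g0Form x S') : S = S' := by
  ext1 v
  refine ext_inner_left ℝ fun u => ?_
  rw [← g0Form_apply, h, g0Form_apply]

lemma exists_g0Form (x : S2) (h : T x →L[ℝ] T x →L[ℝ] ℝ) : ∃ S : EndT x, g0Form x S = h := by
  refine ⟨(h (frame x)).smulRight (frame x) +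
    (h (J0 x (frame x))).smulRight (J0 x (frame x)), ?_⟩
  ext u v
  rw [g0Form_apply]
  conv_rhs => rw [eq_frame_sum x u]
  simp only [add_apply, ContinuousLinearMap.smulRight_apply, inner_add_right, inner_smul_right,
    map_add, map_smul, smul_apply, smul_eq_mul]
  rw [real_inner_comm u, real_inner_comm u]
  ring

/-! ### Coordinates of endomorphisms of a tangent plane -/

section

variable {x : S2}

/-- The endomorphism with conformal factor `w` and anticonformal factor `z`. -/
def ca (x : S2) (w z : ℂ) : EndT x := conf x w + anti x z

/-- The conjugations come from moving the reflection past a conformal factor. With this rule and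
`ca_inj`, later operator identities become pairs of identities between complex numbers. -/
lemma ca_mul (w z w' z' : ℂ) :
    ca x w z * ca x w' z' = ca x (w * w' + z * conj z') (w * z' + z * conj w') := by
  simp only [ca, add_mul, mul_add, conf_mul_conf, conf_mul_anti, anti_mul_conf, anti_mul_anti,
    conf_add, anti_add]
  abel

lemma ca_add (w z w' z' : ℂ) : ca x w z + ca x w' z' = ca x (w + w') (z + z') := by
  simp only [ca, conf_add, anti_add]
  abel

lemma ca_neg (w z : ℂ) : -ca x w z = ca x (-w) (-z) := by
  simp only [ca, conf_neg, anti_neg]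
  abel

lemma ca_sub (w z w' z' : ℂ) : ca x w z - ca x w' z' = ca x (w - w') (z - z') := by
  simp only [ca, conf_sub, anti_sub]
  abel

lemma one_eq_ca : (1 : EndT x) = ca x 1 0 := by
  rw [ca, conf_one, anti_zero, add_zero]

lemma zero_eq_ca : (0 : EndT x) = ca x 0 0 := by
  rw [ca, conf_zero, anti_zero, add_zero]

lemma anti_eq_ca (z : ℂ) : anti x z = ca x 0 z := by
  rw [ca, conf_zero, zero_add]

lemma J0_eq_ca (x : S2) : J0 x = ca x Complex.I 0 := by
  rw [ca, conf_I, anti_zero, add_zero]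

lemma smul_ca (r : ℝ) (w z : ℂ) : r • ca x w z = ca x (r * w) (r * z) := by
  rw [← conf_ofReal_mul, ca, mul_add, conf_mul_conf, conf_mul_anti, ca]

lemma smul_anti (r : ℝ) (z : ℂ) : r • anti x z = anti x (r * z) := by
  rw [← conf_ofReal_mul, conf_mul_anti]

lemma ca_congr {w z w' z' : ℂ} (hw : w = w') (hz : z = z') : ca x w z = ca x w' z' := by
  rw [hw, hz]

lemma ca_inj {w z w' z' : ℂ} (h : ca x w z = ca x w' z') : w = w' ∧ z = z' := conf_add_anti_inj h

lemma eq_ca (L : EndT x) : L = ca x (cconf L) (canti L) := eq_conf_add_anti L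

lemma trace_ca (w z : ℂ) :
    LinearMap.trace ℝ (T x) ((ca x w z : EndT x) : T x →ₗ[ℝ] T x) = 2 * w.re := by
  rw [ca, ContinuousLinearMap.toLinearMap_add, map_add, trace_conf, trace_anti, add_zero]

lemma inner_ca_left {w : ℂ} (hw : conj w = w) (z : ℂ) (u v : T x) :
    ⟪ca x w z u, v⟫_ℝ = ⟪u, ca x w z v⟫_ℝ := by
  rw [ca, add_apply, add_apply, inner_add_left, inner_add_right, inner_conf_left, hw,
    inner_anti_left]

lemma inverse_eq_of_mul {a b : EndT x} (h1 : a * b = 1) (h2 : b * a = 1) : Ring.inverse a = b :=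
  Ring.inverse_unit ⟨a, b, h1, h2⟩

lemma one_sub_normSq (p : ℂ) : (1 - p * conj p : ℂ) = ((1 - Complex.normSq p : ℝ) : ℂ) := by
  rw [Complex.mul_conj]; push_cast; rfl

lemma one_sub_ne_zero {p : ℂ} (hp : Complex.normSq p < 1) : (1 - p * conj p : ℂ) ≠ 0 := by
  rw [one_sub_normSq, Complex.ofReal_ne_zero]
  linarith

/-- Since P² is the scalar |p|², one has (1 - P)(1 + P) = 1 - |p|², and the inverse is (1 + P)/(1 -
|p|²). -/
lemma inverse_one_sub {p : ℂ} (hp : Complex.normSq p < 1) :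
    Ring.inverse (1 - anti x p) = ca x (1 / (1 - p * conj p)) (p / (1 - p * conj p)) := by
  have h := one_sub_ne_zero hp
  have h' : (1 - conj p * p : ℂ) ≠ 0 := by rwa [mul_comm]
  rw [anti_eq_ca, one_eq_ca, ca_sub]
  apply inverse_eq_of_mul <;>
  · rw [ca_mul, one_eq_ca]
    apply ca_congr <;> simp only [map_div₀, map_sub, map_mul, map_one, Complex.conj_conj,
      map_zero] <;> field_simp <;> ring

/-- The operator `(1 + P) (1 - P)⁻¹`. -/
lemma cayley_eq {p : ℂ} (hp : Complex.normSq p < 1) :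
    (1 + anti x p) * Ring.inverse (1 - anti x p) =
      ca x ((1 + p * conj p) / (1 - p * conj p)) (2 * p / (1 - p * conj p)) := by
  have h := one_sub_ne_zero hp
  have h' : (1 - conj p * p : ℂ) ≠ 0 := by rwa [mul_comm]
  rw [inverse_one_sub hp, anti_eq_ca, one_eq_ca, ca_add, ca_mul]
  apply ca_congr <;> simp only [map_div₀, map_sub, map_mul, map_one, Complex.conj_conj] <;> field_simp <;> ring

/-- The operator `2 (1 - P)⁻¹ A (1 - P)⁻¹`. -/
lemma hop_eq {p : ℂ} (hp : Complex.normSq p < 1) (a : ℂ) :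
    (2 : ℝ) • (Ring.inverse (1 - anti x p) * anti x a * Ring.inverse (1 - anti x p)) =
      ca x (2 * (p * conj a + a * conj p) / (1 - p * conj p) ^ 2)
        (2 * (a + p ^ 2 * conj a) / (1 - p * conj p) ^ 2) := by
  have h := one_sub_ne_zero hp
  have h' : (1 - conj p * p : ℂ) ≠ 0 := by rwa [mul_comm]
  rw [inverse_one_sub hp, anti_eq_ca, ca_mul, ca_mul, smul_ca]
  apply ca_congr <;> simp only [map_div₀, map_sub, map_mul, map_one, Complex.conj_conj,
      map_zero, Complex.ofReal_ofNat] <;> field_simp <;> ring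

end

/-! ### The model space -/

/-- The complex factor of an anticonformal field. -/
def co (A : EndField) (x : S2) : ℂ := canti (A x)

lemma eq_anti_co {A : EndField} (hA : A ∈ endSJ0) (x : S2) : A x = anti x (co A x) :=
  eq_anti (hA.2.2 x)

lemma endField_ext {A B : EndField} (hA : A ∈ endSJ0) (hB : B ∈ endSJ0)
    (h : ∀ x, co A x = co B x) : A = B := by
  funext x
  rw [eq_anti_co hA, eq_anti_co hB, h]

lemma co_anti {A : EndField} {x : S2} {z : ℂ} (h : A x = anti x z) : co A x = z := by
  rw [co, h, canti_anti]

lemma mem_endSJ0_of_anti {A : EndField} (hA : IsSmoothEnd A) (z : S2 → ℂ)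
    (h : ∀ x, A x = anti x (z x)) : A ∈ endSJ0 :=
  ⟨hA, fun x u v => by rw [h, inner_anti_left], fun x u => by rw [h, anti_J0]⟩

lemma co_add {A B : EndField} (hA : A ∈ endSJ0) (hB : B ∈ endSJ0) (x : S2) :
    co (A + B) x = co A x + co B x := by
  apply co_anti
  rw [Pi.add_apply, eq_anti_co hA, eq_anti_co hB, anti_add]

lemma co_sub {A B : EndField} (hA : A ∈ endSJ0) (hB : B ∈ endSJ0) (x : S2) :
    co (A - B) x = co A x - co B x := by
  apply co_anti
  rw [Pi.sub_apply, eq_anti_co hA, eq_anti_co hB, anti_sub]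

lemma co_smul {A : EndField} (hA : A ∈ endSJ0) (r : ℝ) (x : S2) :
    co (r • A) x = r * co A x := by
  apply co_anti
  rw [Pi.smul_apply, eq_anti_co hA, smul_anti]

/-- Another frame multiplies both factors by the same unit complex number, so a b̄ does not depend
on the frame. Its real part is half the trace of AB, hence smooth even at the poles. -/
lemma smoothFun_re {A B : EndField} (hA : A ∈ endSJ0) (hB : B ∈ endSJ0) :
    SmoothFun (fun x => (co A x * conj (co B x)).re) := by
  have h := (hA.1.mul hB.1).trace
  have h2 : (fun x => (co A x * conj (co B x)).re) =
      fun x => 2⁻¹ * LinearMap.trace ℝ (T x) ((A x * B x : EndT x) : T x →ₗ[ℝ] T x) := by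
    funext x
    rw [eq_anti_co hA, eq_anti_co hB, anti_mul_anti, trace_conf]
    ring
  rw [h2]
  exact contMDiff_const.mul h

lemma normSq_eq_re (z : ℂ) : Complex.normSq z = (z * conj z).re := by
  rw [Complex.mul_conj, Complex.ofReal_re]

lemma smoothFun_normSq {A : EndField} (hA : A ∈ endSJ0) :
    SmoothFun (fun x => Complex.normSq (co A x)) := by
  simp only [normSq_eq_re]
  exact smoothFun_re hA hA

lemma mem_paramDomain {P : EndField} :
    P ∈ paramDomain ↔ P ∈ endSJ0 ∧ ∀ x, Complex.normSq (co P x) < 1 := by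
  refine and_congr_right fun hP => forall_congr' fun x => ?_
  have key : ∀ u : T x, ⟪u, (1 - P x * P x) u⟫_ℝ = (1 - Complex.normSq (co P x)) * ⟪u, u⟫_ℝ := by
    intro u
    rw [eq_anti_co hP, anti_mul_anti, Complex.mul_conj, ← conf_one, ← conf_sub, ← Complex.ofReal_one,
      ← Complex.ofReal_sub, conf_apply, Complex.ofReal_re, Complex.ofReal_im, zero_smul, add_zero,
      inner_smul_right]
  constructor
  · intro h
    have h0 : frame x ≠ 0 := by
      intro h0
      have := inner_frame_self x
      rw [h0, inner_zero_left] at this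
      exact zero_ne_one this
    have := h _ h0
    rw [key, inner_frame_self] at this
    linarith
  · intro h u hu
    rw [key]
    have : 0 < ⟪u, u⟫_ℝ := real_inner_self_pos.2 hu
    exact mul_pos (by linarith) this

lemma smoothFun_inv {P : EndField} (hP : P ∈ paramDomain) :
    SmoothFun (fun x => (1 - Complex.normSq (co P x))⁻¹) := by
  obtain ⟨hP, hlt⟩ := mem_paramDomain.1 hP
  exact ContMDiff.inv₀ (contMDiff_const.sub (smoothFun_normSq hP)) fun x => by
    have := hlt x
    linarith

/-! ### The parametrization -/

/-- The operator `S` with `psi P = g₀ S`. -/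
def cayley (P : EndField) : EndField := fun x => (1 + P x) * Ring.inverse (1 - P x)

lemma psi_eq (P : EndField) (x : S2) : psi P x = g0Form x (cayley P x) := rfl

lemma cayley_apply {P : EndField} (hP : P ∈ paramDomain) (x : S2) :
    cayley P x = ca x ((1 + co P x * conj (co P x)) / (1 - co P x * conj (co P x)))
      (2 * co P x / (1 - co P x * conj (co P x))) := by
  obtain ⟨hP, hlt⟩ := mem_paramDomain.1 hP
  rw [cayley, ← cayley_eq (hlt x), ← eq_anti_co hP]

lemma isSmoothEnd_inverse {P : EndField} (hP : P ∈ paramDomain) :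
    IsSmoothEnd (fun x => Ring.inverse (1 - P x)) := by
  have h : (fun x => Ring.inverse (1 - P x)) =
      fun x => (1 - Complex.normSq (co P x))⁻¹ • (1 + P x) := by
    funext x
    obtain ⟨hP, hlt⟩ := mem_paramDomain.1 hP
    have h := one_sub_normSq (co P x)
    rw [eq_anti_co hP, inverse_one_sub (hlt x), anti_eq_ca, one_eq_ca, ca_add, smul_ca, h]
    apply ca_congr <;> push_cast <;> ring
  rw [h]
  exact (isSmoothEnd_one.add hP.1.1).smul (smoothFun_inv hP)

lemma isSmoothEnd_cayley {P : EndField} (hP : P ∈ paramDomain) : IsSmoothEnd (cayley P) :=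
  (isSmoothEnd_one.add hP.1.1).mul (isSmoothEnd_inverse hP)

/-- The almost complex structure of `psi P`. -/
lemma isMetricOf_psi (P : EndField) : IsMetricOf (psi P) (fun x => J0 x * cayley P x) := by
  intro x u v
  rw [psi_eq, g0Form_apply, omega_eq, mul_apply_eq_comp, inner_J0_J0]

/-- With S = (1 + P)(1 - P)⁻¹, everything follows from S being symmetric with S J₀ S = J₀ (that is,
det S = 1) and from S = (1 + P)²/(1 - |p|²), which makes it positive. -/
lemma isAssociatedACS_psi {P : EndField} (hP : P ∈ paramDomain) :
    IsAssociatedACS (fun x => J0 x * cayley P x) := by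
  obtain ⟨hPe, hlt⟩ := mem_paramDomain.1 hP
  have hD := fun x => one_sub_ne_zero (hlt x)
  have hreal : ∀ x, conj ((1 + co P x * conj (co P x)) / (1 - co P x * conj (co P x))) =
      (1 + co P x * conj (co P x)) / (1 - co P x * conj (co P x)) := by
    intro x
    simp only [map_div₀, map_add, map_sub, map_mul, map_one, Complex.conj_conj, mul_comm]
  have hsymm : ∀ x (u v : T x), ⟪cayley P x u, v⟫_ℝ = ⟪u, cayley P x v⟫_ℝ := by
    intro x u v
    rw [cayley_apply hP, inner_ca_left (hreal x)]
  have hJ : ∀ x, cayley P x * (J0 x * cayley P x) = J0 x := by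
    intro x
    have h := hD x
    have h' : (1 - conj (co P x) * co P x : ℂ) ≠ 0 := by rwa [mul_comm]
    rw [cayley_apply hP, J0_eq_ca, ca_mul, ca_mul]
    apply ca_congr <;> simp only [map_div₀, map_sub, map_add, map_mul, map_one, Complex.conj_conj,
      map_zero, Complex.conj_I, map_ofNat] <;> field_simp <;> ring
  refine ⟨isSmoothEnd_J0.mul (isSmoothEnd_cayley hP), fun x u => ?_, fun x u v => ?_,
    fun x u hu => ?_⟩
  · have h : (J0 x * cayley P x) * (J0 x * cayley P x) = -1 := by
      rw [mul_assoc, hJ, J0_mul_J0]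
    exact congrArg (fun L : EndT x => L u) h
  · have h := congrArg (fun L : EndT x => L v) (hJ x)
    simp only [mul_apply_eq_comp] at h
    simp only [omega_eq, mul_apply_eq_comp]
    rw [J0_J0_apply, inner_neg_left, hsymm, h, inner_J0_left]
  · have hr : 0 < 1 - Complex.normSq (co P x) := by
      have := hlt x
      linarith
    have h : cayley P x = (1 - Complex.normSq (co P x))⁻¹ • ((1 + P x) * (1 + P x)) := by
      rw [cayley_apply hP, eq_anti_co hPe, anti_eq_ca, one_eq_ca, ca_add, ca_mul, smul_ca,
        one_sub_normSq, co_anti (A := P) (eq_anti_co hPe x)]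
      apply ca_congr <;> simp only [map_add, map_zero, map_one] <;> push_cast <;> ring
    -- The operator 1 + P is injective because (1 - P)(1 + P) is a nonzero scalar.
    have hne : (1 + P x) u ≠ 0 := by
      intro h0
      have h1 : (1 - P x) * (1 + P x) = conf x ((1 - Complex.normSq (co P x) : ℝ) : ℂ) := by
        rw [← one_sub_normSq, eq_anti_co hPe, mul_add, sub_mul, sub_mul, anti_mul_anti, one_mul,
          mul_one, conf_sub, conf_one, one_mul, co_anti (A := P) (eq_anti_co hPe x)]
        abel
      have h2 := congrArg (fun L : EndT x => L u) h1
      simp only [mul_apply_eq_comp, h0, map_zero, conf_apply, Complex.ofReal_re, Complex.ofReal_im,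
        zero_smul, add_zero] at h2
      exact (smul_ne_zero hr.ne' hu) h2.symm
    have hPs : ∀ u v : T x, ⟪(1 + P x) u, v⟫_ℝ = ⟪u, (1 + P x) v⟫_ℝ := by
      intro u v
      rw [add_apply, add_apply, inner_add_left, inner_add_right, hPe.2.1]
      rfl
    rw [omega_eq, mul_apply_eq_comp, inner_J0_J0, h, smul_apply, inner_smul_right,
      mul_apply_eq_comp, ← hPs]
    exact mul_pos (inv_pos.2 hr) (real_inner_self_pos.2 hne)

/-! ### Bijectivity of the parametrization. -/

lemma psi_mem_AM {P : EndField} (hP : P ∈ paramDomain) : psi P ∈ AM :=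
  ⟨_, isAssociatedACS_psi hP, isMetricOf_psi P⟩

/-- The conformal factor plus one equals 2/(1 - |p|²), so it determines |p|; the anticonformal
factor 2p/(1 - |p|²) then determines p. -/
lemma psi_injOn : Set.InjOn psi paramDomain := by
  intro P hP Q hQ h
  obtain ⟨hPe, hPlt⟩ := mem_paramDomain.1 hP
  obtain ⟨hQe, hQlt⟩ := mem_paramDomain.1 hQ
  refine endField_ext hPe hQe fun x => ?_
  have h1 := congrFun h x
  rw [psi_eq, psi_eq] at h1
  have h2 := g0Form_injective h1
  rw [cayley_apply hP, cayley_apply hQ] at h2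
  obtain ⟨hw, hz⟩ := ca_inj h2
  have hp := one_sub_ne_zero (hPlt x)
  have hq := one_sub_ne_zero (hQlt x)
  have e : ∀ {p : ℂ}, (1 - p * conj p : ℂ) ≠ 0 →
      (1 + p * conj p) / (1 - p * conj p) + 1 = 2 / (1 - p * conj p) := by
    intro p h
    field_simp
    ring
  have e1 : 2 / (1 - co P x * conj (co P x)) = 2 / (1 - co Q x * conj (co Q x)) := by
    rw [← e hp, ← e hq, hw]
  have e2 : 1 - co P x * conj (co P x) = 1 - co Q x * conj (co Q x) := by
    field_simp at e1
    exact e1.symm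
  rw [e2] at hz
  field_simp at hz
  exact hz

/-- Nondegeneracy of ω. It allows the existentially quantified structure J of a metric `psi P` to be
replaced by the explicit J₀ S. -/
lemma metric_unique {g : FormField} {J J' : EndField} (h : IsMetricOf g J)
    (h' : IsMetricOf g J') : J = J' := by
  funext x
  ext1 v
  refine ext_inner_left ℝ fun u => ?_
  have e := (h x (-J0 x u) v).symm.trans (h' x (-J0 x u) v)
  rwa [omega_eq, omega_eq, map_neg, J0_J0_apply, neg_neg] at e

/-- Write g = g₀ S with S = -J₀ J = w + z·(reflection). From J² = -1 one gets w² = 1 + |z|², and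
positivity of the trace makes w real and positive. The Cayley transform is then inverted by p = z/(1
+ w). -/
lemma psi_surjOn : Set.SurjOn psi paramDomain AM := by
  rintro g ⟨J, hJ, hg⟩
  have hS : ∀ x, g x = g0Form x (-(J0 x * J x)) := by
    intro x
    ext u v
    rw [hg, g0Form_apply, omega_eq, inner_J0_left, neg_apply, inner_neg_right]
    rfl
  set S : EndField := fun x => -(J0 x * J x) with hSdef
  have hSs : IsSmoothEnd S := (isSmoothEnd_J0.mul hJ.smooth).neg
  set w : S2 → ℂ := fun x => cconf (S x)
  set z : S2 → ℂ := fun x => canti (S x)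
  have hSca : ∀ x, S x = ca x (w x) (z x) := fun x => eq_ca (S x)
  have hJS : ∀ x, J x = J0 x * S x := by
    intro x
    ext1 u
    rw [hSdef, mul_apply_eq_comp, neg_apply, mul_apply_eq_comp, map_neg, J0_J0_apply, neg_neg]
  have hsq : ∀ x, w x ^ 2 = 1 + z x * conj (z x) := by
    intro x
    have h : J x * J x = -1 := by
      ext1 u
      exact hJ.sq x u
    rw [hJS, hSca, J0_eq_ca, ca_mul, ca_mul, one_eq_ca, ca_neg] at h
    have h1 := (ca_inj h).1
    simp only [zero_mul, add_zero, map_mul, Complex.conj_I] at h1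
    linear_combination -h1 + (w x ^ 2 - z x * conj (z x)) * Complex.I_sq
  have hpos : ∀ x, 0 < (w x).re := by
    intro x
    have h : ∀ u : T x, u ≠ 0 → 0 < ⟪u, S x u⟫_ℝ := by
      intro u hu
      have := hJ.pos x u hu
      rwa [hJS, omega_eq, mul_apply_eq_comp, inner_J0_J0] at this
    have hne : frame x ≠ 0 := by
      intro h0
      have := inner_frame_self x
      rw [h0, inner_zero_left] at this
      exact zero_ne_one this
    have hne' : J0 x (frame x) ≠ 0 := by
      intro h0
      have := inner_J0_frame_self (x := x)
      rw [h0, inner_zero_left] at this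
      exact zero_ne_one this
    have := add_pos (h _ hne) (h _ hne')
    rw [← trace_eq, hSca, trace_ca] at this
    linarith
  have hreal : ∀ x, w x = ((w x).re : ℂ) := by
    intro x
    have h1 := congrArg Complex.im (hsq x)
    rw [Complex.mul_conj] at h1
    simp only [sq, Complex.mul_im, Complex.add_im, Complex.one_im, Complex.ofReal_im] at h1
    have h2 : (w x).re * (w x).im = 0 := by linarith
    have h3 := (mul_eq_zero.1 h2).resolve_left (hpos x).ne'
    apply Complex.ext <;> simp [h3]
  have hnorm : ∀ x, (w x).re ^ 2 = 1 + Complex.normSq (z x) := by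
    intro x
    have h := hsq x
    rw [Complex.mul_conj, hreal x] at h
    exact_mod_cast h
  have hwre : ∀ x, (w x).re = 2⁻¹ * LinearMap.trace ℝ (T x) (S x : T x →ₗ[ℝ] T x) := by
    intro x
    rw [hSca, trace_ca]
    ring
  have hws : SmoothFun (fun x => (w x).re) := by
    simp only [hwre]
    exact contMDiff_const.mul hSs.trace
  have hwne : ∀ x, 1 + (w x).re ≠ 0 := fun x => by
    have := hpos x
    linarith
  -- The factor z/(1 + w) is written through S and w = ½ tr S, both smooth, because z alone depends
  -- on the discontinuous frame.
  let P : EndField := fun x => (1 + (w x).re)⁻¹ • (S x - (w x).re • 1)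
  have hPval : ∀ x, P x = anti x (z x / (1 + w x)) := by
    intro x
    change (1 + (w x).re)⁻¹ • (S x - (w x).re • 1) = _
    rw [hSca, one_eq_ca, smul_ca, ca_sub, smul_ca, anti_eq_ca]
    apply ca_congr
    · rw [mul_one, ← hreal, sub_self, mul_zero]
    · rw [mul_zero, sub_zero]
      push_cast
      rw [← hreal]
      ring
  have hPs : IsSmoothEnd P := by
    have h1 : SmoothFun (fun x => (1 + (w x).re)⁻¹) := ContMDiff.inv₀ (contMDiff_const.add hws) hwne
    exact (hSs.sub (isSmoothEnd_one.smul hws)).smul h1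
  have hPe : P ∈ endSJ0 := mem_endSJ0_of_anti hPs _ hPval
  have hPco : ∀ x, co P x = z x / (1 + w x) := fun x => co_anti (hPval x)
  have hPD : P ∈ paramDomain := by
    refine mem_paramDomain.2 ⟨hPe, fun x => ?_⟩
    rw [hPco, hreal x, Complex.normSq_div, ← Complex.ofReal_one, ← Complex.ofReal_add,
      Complex.normSq_ofReal]
    have h1 := hpos x
    have h2 := hnorm x
    -- What remains is |z|² = w² - 1 < (1 + w)², which holds since w > 0.
    rw [div_lt_one (by positivity)]
    nlinarith
  refine ⟨P, hPD, ?_⟩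
  funext x
  rw [psi_eq, hS, cayley_apply hPD]
  change _ = g0Form x (S x)
  rw [hSca x]
  congr 1
  have hc : conj (w x) = w x := by rw [hreal x, Complex.conj_ofReal]
  have h1 : 1 + w x ≠ 0 := by
    rw [hreal x, ← Complex.ofReal_one, ← Complex.ofReal_add, Complex.ofReal_ne_zero]
    exact hwne x
  have h2 : co P x * conj (co P x) = (w x - 1) / (w x + 1) := by
    rw [hPco, map_div₀, map_add, map_one, hc]
    have h1' : w x + 1 ≠ 0 := by rwa [add_comm]
    rw [div_mul_div_comm, div_eq_div_iff (mul_ne_zero h1 h1) h1']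
    linear_combination -(w x + 1) * hsq x
  have h3 : 1 - (w x - 1) / (w x + 1) = 2 / (1 + w x) := by
    have h1' : w x + 1 ≠ 0 := by rwa [add_comm]
    field_simp
    ring
  have h4 : 1 + (w x - 1) / (w x + 1) = 2 * w x / (1 + w x) := by
    have h1' : w x + 1 ≠ 0 := by rwa [add_comm]
    field_simp
    ring
  rw [h2, h3, h4, hPco]
  apply ca_congr <;> field_simp

lemma psi_bijOn : Set.BijOn psi paramDomain AM :=
  ⟨fun _ hP => psi_mem_AM hP, psi_injOn, psi_surjOn⟩

/-! ### The differential of the parametrization -/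

/-- The product rule gives (1 + (1 + P)(1 - P)⁻¹) A (1 - P)⁻¹, and the first bracket is 2(1 - P)⁻¹.
Commutativity of A and P is not needed. -/
lemma hasDerivAt_one_add_mul_inverse_one_sub {R : Type*} [NormedRing R] [NormedAlgebra ℝ R]
    [CompleteSpace R] (P A : R) (h : IsUnit (1 - P)) :
    HasDerivAt (fun t : ℝ => (1 + (P + t • A)) * Ring.inverse (1 - (P + t • A)))
      ((2 : ℝ) • (Ring.inverse (1 - P) * A * Ring.inverse (1 - P))) 0 := by
  obtain ⟨u, hu⟩ := h
  have h0 : HasDerivAt (fun t : ℝ => P + t • A) A 0 := by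
    simpa using ((hasDerivAt_id (0 : ℝ)).smul_const A).const_add P
  have h1 : HasDerivAt (fun t : ℝ => 1 - (P + t • A)) (-A) 0 := h0.const_sub 1
  have h2 : HasFDerivAt Ring.inverse (-((ContinuousLinearMap.mulLeftRight ℝ R) ↑u⁻¹) ↑u⁻¹)
      (1 - (P + (0 : ℝ) • A)) := by
    rw [zero_smul, add_zero, ← hu]
    exact hasFDerivAt_ringInverse u
  have h3 := h2.comp_hasDerivAt (0 : ℝ) h1
  have h4 := (h0.const_add 1).mul h3
  have e : (1 : R) + (1 + P) * ↑u⁻¹ = (2 : ℝ) • (↑u⁻¹ : R) := by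
    have e1 : (1 - P) * (↑u⁻¹ : R) = 1 := by rw [← hu, Units.mul_inv]
    have e2 : (1 : R) + (1 + P) * ↑u⁻¹ = (1 - P) * ↑u⁻¹ + (1 + P) * ↑u⁻¹ := by rw [e1]
    rw [e2, ← add_mul, two_smul]
    noncomm_ring
  have e3 : (-((ContinuousLinearMap.mulLeftRight ℝ R) ↑u⁻¹) ↑u⁻¹) (-A) = ↑u⁻¹ * A * ↑u⁻¹ := by
    rw [neg_apply, map_neg, neg_neg, ContinuousLinearMap.mulLeftRight_apply]
  refine h4.congr_deriv ?_
  rw [e3, zero_smul, add_zero, Function.comp_apply, zero_smul, add_zero, ← hu, Ring.inverse_unit,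
    ← smul_mul_assoc, ← smul_mul_assoc, ← e]
  noncomm_ring

section

variable {V : Type*} [NormedAddCommGroup V] [InnerProductSpace ℝ V] [FiniteDimensional ℝ V]

/-- The bilinear form `(u, v) ↦ ⟪u, S v⟫`, as a linear function of `S`. -/
def formOf : (V →L[ℝ] V) →ₗ[ℝ] (V →L[ℝ] V →L[ℝ] ℝ) where
  toFun S := (innerSL ℝ).bilinearComp (ContinuousLinearMap.id ℝ V) S
  map_add' S S' := by
    ext u v
    exact inner_add_right _ _ _
  map_smul' c S := by
    ext u v
    exact inner_smul_right _ _ _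

lemma hasDerivAt_linearMap_comp {E F : Type*} [NormedAddCommGroup E] [NormedSpace ℝ E]
    [FiniteDimensional ℝ E] [NormedAddCommGroup F] [NormedSpace ℝ F] (L : E →ₗ[ℝ] F) {f : ℝ → E}
    {f' : E} {t : ℝ} (hf : HasDerivAt f f' t) : HasDerivAt (fun t => L (f t)) (L f') t :=
  (LinearMap.toContinuousLinearMap L).hasFDerivAt.comp_hasDerivAt t hf

lemma deriv_formOf_cayley (P A : V →L[ℝ] V) (h : IsUnit (1 - P)) :
    deriv (fun t : ℝ => formOf ((1 + (P + t • A)) * Ring.inverse (1 - (P + t • A)))) 0 =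
      (2 : ℝ) • formOf (Ring.inverse (1 - P) * A * Ring.inverse (1 - P)) := by
  have : CompleteSpace V := FiniteDimensional.complete ℝ V
  have h1 := hasDerivAt_one_add_mul_inverse_one_sub P A h
  have h2 := hasDerivAt_linearMap_comp (E := V →L[ℝ] V) (F := V →L[ℝ] V →L[ℝ] ℝ) formOf h1
  rw [← map_smul]
  exact h2.deriv

end

lemma isUnit_one_sub {P : EndField} (hP : P ∈ paramDomain) (x : S2) : IsUnit (1 - P x) := by
  obtain ⟨hPe, hlt⟩ := mem_paramDomain.1 hP
  by_contra h
  -- `Ring.inverse` is zero at non-units, whereas the computed value has a nonzero conformal factor.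
  have h1 := Ring.inverse_non_unit _ h
  rw [eq_anti_co hPe, inverse_one_sub (hlt x), zero_eq_ca] at h1
  exact one_div_ne_zero (one_sub_ne_zero (hlt x)) (ca_inj h1).1

lemma dPsi_eq {P : EndField} (hP : P ∈ paramDomain) (A : EndField) : dPsi P A = hForm P A := by
  funext x
  exact deriv_formOf_cayley (V := T x) (P x) (A x) (isUnit_one_sub hP x)

/-- The operator `H` with `hForm P A = g₀ H`. -/
def hOp (P A : EndField) : EndField := fun x =>
  (2 : ℝ) • (Ring.inverse (1 - P x) * A x * Ring.inverse (1 - P x))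

lemma hForm_eq (P A : EndField) (x : S2) : hForm P A x = g0Form x (hOp P A x) := by
  ext u v
  rw [g0Form_apply, hOp, smul_apply, inner_smul_right]
  rfl

lemma hOp_apply {P A : EndField} (hP : P ∈ paramDomain) (hA : A ∈ endSJ0) (x : S2) :
    hOp P A x = ca x (2 * (co P x * conj (co A x) + co A x * conj (co P x)) /
        (1 - co P x * conj (co P x)) ^ 2)
      (2 * (co A x + co P x ^ 2 * conj (co A x)) / (1 - co P x * conj (co P x)) ^ 2) := by
  obtain ⟨hPe, hlt⟩ := mem_paramDomain.1 hP
  rw [hOp, ← hop_eq (hlt x), ← eq_anti_co hPe, ← eq_anti_co hA]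

lemma hOp_symm {P A : EndField} (hP : P ∈ paramDomain) (hA : A ∈ endSJ0) (x : S2) (u v : T x) :
    ⟪hOp P A x u, v⟫_ℝ = ⟪u, hOp P A x v⟫_ℝ := by
  rw [hOp_apply hP hA, inner_ca_left]
  simp only [map_div₀, map_add, map_sub, map_mul, map_one, Complex.conj_conj, map_ofNat, map_pow]
  ring

lemma cayley_symm {P : EndField} (hP : P ∈ paramDomain) (x : S2) (u v : T x) :
    ⟪cayley P x u, v⟫_ℝ = ⟪u, cayley P x v⟫_ℝ := by
  rw [cayley_apply hP, inner_ca_left]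
  simp only [map_div₀, map_add, map_sub, map_mul, map_one, Complex.conj_conj, mul_comm]

lemma isSmoothEnd_hOp {P A : EndField} (hP : P ∈ paramDomain) (hA : A ∈ endSJ0) :
    IsSmoothEnd (hOp P A) :=
  (((isSmoothEnd_inverse hP).mul hA.1).mul (isSmoothEnd_inverse hP)).smul contMDiff_const

lemma J0_ca_J0 (x : S2) (w z : ℂ) : J0 x * ca x w z * J0 x = ca x (-w) z := by
  rw [J0_eq_ca, ca_mul, ca_mul]
  apply ca_congr <;> simp only [map_zero, Complex.conj_I]
  · linear_combination w * Complex.I_sq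
  · linear_combination -z * Complex.I_sq

/-- It translates the anti-Hermitian condition on h = g₀ H into the operator equation S (J₀ H J₀) S
= H. -/
lemma inner_J_psi {P : EndField} (hP : P ∈ paramDomain) (x : S2) (H : EndT x) (u v : T x) :
    ⟪(J0 x * cayley P x) u, H ((J0 x * cayley P x) v)⟫_ℝ =
      -⟪u, (cayley P x * (J0 x * H * J0 x) * cayley P x) v⟫_ℝ := by
  simp only [mul_apply_eq_comp]
  rw [inner_J0_left, cayley_symm hP]

lemma hForm_mem_tangentAM {P A : EndField} (hP : P ∈ paramDomain) (hA : A ∈ endSJ0) :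
    hForm P A ∈ tangentAM (psi P) := by
  obtain ⟨hPe, hlt⟩ := mem_paramDomain.1 hP
  refine ⟨?_, fun x u v => ?_, _, isAssociatedACS_psi hP, isMetricOf_psi P, fun x u v => ?_⟩
  · have h := isSmoothForm_g0Form.2 (isSmoothEnd_hOp hP hA)
    intro u v
    simpa only [hForm_eq] using h u v
  · rw [hForm_eq, g0Form_apply, g0Form_apply, ← hOp_symm hP hA, real_inner_comm]
  · rw [hForm_eq, g0Form_apply, g0Form_apply, inner_J_psi hP]
    congr 3
    have h := one_sub_ne_zero (hlt x)
    have h' : (1 - conj (co P x) * co P x : ℂ) ≠ 0 := by rwa [mul_comm]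
    rw [cayley_apply hP, hOp_apply hP hA, J0_ca_J0, ca_mul, ca_mul]
    apply ca_congr <;> simp only [map_div₀, map_sub, map_add, map_mul, map_one, Complex.conj_conj,
      map_neg, map_ofNat, map_pow] <;> field_simp <;> ring

lemma hForm_injOn {P : EndField} (hP : P ∈ paramDomain) :
    Set.InjOn (hForm P) (endSJ0 : Set EndField) := by
  intro A _ B _ h
  funext x
  have h1 := congrFun h x
  rw [hForm_eq, hForm_eq] at h1
  have h2 := g0Form_injective h1
  have h3 : Ring.inverse (1 - P x) * A x * Ring.inverse (1 - P x) =
      Ring.inverse (1 - P x) * B x * Ring.inverse (1 - P x) := by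
    ext1 u
    have h4 := congrArg (fun L : EndT x => L u) h2
    exact smul_right_injective (T x) (two_ne_zero (α := ℝ)) h4
  have hu := isUnit_one_sub hP x
  have h5 : ∀ L : EndT x, (1 - P x) * (Ring.inverse (1 - P x) * L * Ring.inverse (1 - P x)) *
      (1 - P x) = L := by
    intro L
    rw [mul_assoc (Ring.inverse _), ← mul_assoc (1 - P x), Ring.mul_inverse_cancel _ hu, one_mul,
      mul_assoc, Ring.inverse_mul_cancel _ hu, mul_one]
  rw [← h5 (A x), h3, h5]

/-- The preimage can only be A = ½(1 - P) H (1 - P). Its conformal part has to vanish, and this is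
exactly what the anti-Hermitian condition says about the factors of H. -/
lemma hForm_surjOn {P : EndField} (hP : P ∈ paramDomain) :
    Set.SurjOn (hForm P) (endSJ0 : Set EndField) (tangentAM (psi P)) := by
  rintro h ⟨hsm, hsymm, J, -, hJg, hJ⟩
  obtain ⟨hPe, hlt⟩ := mem_paramDomain.1 hP
  obtain rfl := metric_unique hJg (isMetricOf_psi P)
  choose H hH using fun x => exists_g0Form x (h x)
  have hHs : IsSmoothEnd H := isSmoothForm_g0Form.1 (by simpa only [hH] using hsm)
  have hHsymm : ∀ x (u v : T x), ⟪H x u, v⟫_ℝ = ⟪u, H x v⟫_ℝ := by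
    intro x u v
    have := hsymm x v u
    rwa [← hH, g0Form_apply, g0Form_apply, real_inner_comm] at this
  have hHJ : ∀ x, cayley P x * (J0 x * H x * J0 x) * cayley P x = H x := by
    intro x
    ext1 v
    refine ext_inner_left ℝ fun u => ?_
    have := hJ x u v
    rw [← hH, g0Form_apply, g0Form_apply, inner_J_psi hP] at this
    exact neg_injective this
  let A : EndField := fun x => (1 - P x) * ((2 : ℝ)⁻¹ • H x) * (1 - P x)
  have hAs : IsSmoothEnd A := by
    have h1 : IsSmoothEnd (fun x => 1 - P x) := isSmoothEnd_one.sub hPe.1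
    exact (h1.mul (hHs.smul contMDiff_const)).mul h1
  have hA : A ∈ endSJ0 := by
    refine mem_endSJ0_of_anti hAs (fun x => canti (A x)) fun x => ?_
    set r := cconf (H x) with hr
    set c := canti (H x) with hc
    have hr' : conj r = r := Complex.conj_eq_iff_im.2 (cconf_im_eq_zero (hHsymm x))
    have e := hHJ x
    have h0 := one_sub_ne_zero (hlt x)
    have h0' : (1 - conj (co P x) * co P x : ℂ) ≠ 0 := by rwa [mul_comm]
    have h1 : 1 + co P x * conj (co P x) ≠ 0 := by
      rw [Complex.mul_conj, ← Complex.ofReal_one, ← Complex.ofReal_add, Complex.ofReal_ne_zero]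
      have := Complex.normSq_nonneg (co P x)
      linarith
    rw [eq_ca (H x), cayley_apply hP, J0_ca_J0, ca_mul, ca_mul] at e
    have e1 := (ca_inj e).1
    simp only [map_div₀, map_sub, map_mul, map_one, Complex.conj_conj,
      map_neg, map_ofNat, ← hr, ← hc, hr'] at e1
    -- The conformal half of S (J₀ H J₀) S = H is this relation multiplied by the nonzero number 1 +
    -- |p|².
    have e2 : r * (1 + co P x * conj (co P x)) = co P x * conj c + c * conj (co P x) := by
      field_simp at e1
      refine mul_left_cancel₀ h1 ?_
      linear_combination (-1 / 2) * e1
    have e3 : A x = anti x ((c + co P x ^ 2 * conj c) / 2 - co P x * r) := by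
      change (1 - P x) * ((2 : ℝ)⁻¹ • H x) * (1 - P x) = _
      rw [eq_ca (H x), ← hr, ← hc, smul_ca, eq_anti_co hPe, anti_eq_ca, one_eq_ca, anti_eq_ca,
        ca_sub, ca_mul, ca_mul, co_anti (A := P) (eq_anti_co hPe x)]
      apply ca_congr <;> simp only [map_sub, map_mul, map_zero, map_one, Complex.conj_ofReal, hr'] <;>
        push_cast
      · linear_combination e2 / 2
      · ring
    rw [e3, canti_anti]
  refine ⟨A, hA, ?_⟩
  funext x
  rw [hForm_eq, ← hH]
  congr 1
  have hu := isUnit_one_sub hP x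
  have h5 : Ring.inverse (1 - P x) * A x * Ring.inverse (1 - P x) = (2 : ℝ)⁻¹ • H x := by
    change Ring.inverse (1 - P x) * ((1 - P x) * ((2 : ℝ)⁻¹ • H x) * (1 - P x)) * _ = _
    rw [mul_assoc (1 - P x), ← mul_assoc (Ring.inverse _), Ring.inverse_mul_cancel _ hu, one_mul,
      mul_assoc, Ring.mul_inverse_cancel _ hu, mul_one]
  rw [hOp, h5]
  ext1 u
  exact smul_inv_smul₀ (two_ne_zero (α := ℝ)) (H x u)

lemma dPsi_bijOn {P : EndField} (hP : P ∈ paramDomain) :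
    Set.BijOn (dPsi P) (endSJ0 : Set EndField) (tangentAM (psi P)) := by
  rw [funext (dPsi_eq hP)]
  exact ⟨fun _ hA => hForm_mem_tangentAM hP hA, hForm_injOn hP, hForm_surjOn hP⟩

/-! ### The weak Riemannian structure -/

/-- The inverse of w + z·(reflection) is w - z·(reflection), as w² - |z|² = 1. Invertibility ensures
that `inverse` in `raise` is a true inverse and not its default value. -/
lemma psi_isInvertible {P : EndField} (hP : P ∈ paramDomain) (x : S2) :
    ∃ e : T x ≃L[ℝ] (T x →L[ℝ] ℝ), (e : T x →L[ℝ] T x →L[ℝ] ℝ) = psi P x := by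
  obtain ⟨hPe, hlt⟩ := mem_paramDomain.1 hP
  have hinv : ∃ S' : EndT x, cayley P x * S' = 1 := by
    refine ⟨ca x ((1 + co P x * conj (co P x)) / (1 - co P x * conj (co P x)))
      (-(2 * co P x / (1 - co P x * conj (co P x)))), ?_⟩
    have h := one_sub_ne_zero (hlt x)
    have h' : (1 - conj (co P x) * co P x : ℂ) ≠ 0 := by rwa [mul_comm]
    rw [cayley_apply hP, ca_mul, one_eq_ca]
    apply ca_congr <;> simp only [map_div₀, map_add, map_sub, map_mul, map_one, Complex.conj_conj,
      map_neg, map_ofNat] <;> field_simp <;> ring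
  obtain ⟨S', hS'⟩ := hinv
  have hS : ∀ v, cayley P x (S' v) = v := fun v => congrArg (fun L : EndT x => L v) hS'
  have hinj : Function.Injective (psi P x) := by
    intro u v huv
    refine ext_inner_right ℝ fun w => ?_
    have := congrArg (fun l : T x →L[ℝ] ℝ => l (S' w)) huv
    simpa only [psi_eq, g0Form_apply, hS] using this
  have hsurj : Function.Surjective (psi P x) := by
    intro l
    refine ⟨S' (l (frame x) • frame x + l (J0 x (frame x)) • J0 x (frame x)), ?_⟩
    ext v
    rw [psi_eq, g0Form_apply, ← cayley_symm hP, hS, inner_add_left, inner_smul_left,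
      inner_smul_left]
    conv_rhs => rw [eq_frame_sum x v, map_add, map_smul, map_smul]
    simp only [conj_trivial, smul_eq_mul]
    ring
  refine ⟨(LinearEquiv.ofBijective (psi P x : T x →ₗ[ℝ] T x →L[ℝ] ℝ)
    ⟨hinj, hsurj⟩).toContinuousLinearEquiv, ?_⟩
  ext u v
  rfl

lemma raise_apply {P A : EndField} (hP : P ∈ paramDomain) (hA : A ∈ endSJ0) (x : S2) :
    raise (psi P) (hForm P A) x =
      ca x (2 * (co A x * conj (co P x) - co P x * conj (co A x)) /
        (1 - co P x * conj (co P x)) ^ 2)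
      (2 * (co A x - co P x ^ 2 * conj (co A x)) / (1 - co P x * conj (co P x)) ^ 2) := by
  obtain ⟨hPe, hlt⟩ := mem_paramDomain.1 hP
  set R := ca x (2 * (co A x * conj (co P x) - co P x * conj (co A x)) /
        (1 - co P x * conj (co P x)) ^ 2)
      (2 * (co A x - co P x ^ 2 * conj (co A x)) / (1 - co P x * conj (co P x)) ^ 2) with hR
  have hSR : cayley P x * R = hOp P A x := by
    have h := one_sub_ne_zero (hlt x)
    have h' : (1 - conj (co P x) * co P x : ℂ) ≠ 0 := by rwa [mul_comm]
    rw [cayley_apply hP, hOp_apply hP hA, hR, ca_mul]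
    apply ca_congr <;> simp only [map_div₀, map_sub, map_mul, map_one, Complex.conj_conj,
      map_ofNat, map_pow] <;> field_simp <;> ring
  obtain ⟨e, he⟩ := psi_isInvertible hP x
  have h2 : hForm P A x = psi P x ∘L R := by
    ext u v
    rw [hForm_eq, g0Form_apply, ← hOp_symm hP hA, ← hSR, ContinuousLinearMap.comp_apply, psi_eq,
      g0Form_apply, mul_apply_eq_comp, cayley_symm hP]
  rw [raise, h2, ← he, ContinuousLinearMap.inverse_equiv]
  ext1 u
  exact e.symm_apply_apply (R u)

/-- The integrand of the weak Riemannian structure in the chart. -/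
def dens (P A B : EndField) (x : S2) : ℝ :=
  8 * (co A x * conj (co B x)).re / (1 - Complex.normSq (co P x)) ^ 2

/-- Conceptually g⁻¹h_A = 2(1 + P)⁻¹ A (1 - P)⁻¹, and (1 - P²)⁻¹ is the scalar 1/(1 - |p|²). So the
trace is 4 tr(AB)/(1 - |p|²)², with tr(AB) = 2 Re(a b̄). -/
lemma trace_raise {P A B : EndField} (hP : P ∈ paramDomain) (hA : A ∈ endSJ0) (hB : B ∈ endSJ0)
    (x : S2) : LinearMap.trace ℝ (T x)
      ((raise (psi P) (hForm P A) x * raise (psi P) (hForm P B) x : T x →L[ℝ] T x) :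
        T x →ₗ[ℝ] T x) = dens P A B x := by
  obtain ⟨hPe, hlt⟩ := mem_paramDomain.1 hP
  have h := one_sub_ne_zero (hlt x)
  have h' : (1 - conj (co P x) * co P x : ℂ) ≠ 0 := by rwa [mul_comm]
  rw [raise_apply hP hA, raise_apply hP hB, ca_mul, trace_ca, dens]
  have key : ∀ a b p : ℂ, (1 - p * conj p) ≠ 0 →
      (2 * (a * conj p - p * conj a) / (1 - p * conj p) ^ 2 *
          (2 * (b * conj p - p * conj b) / (1 - p * conj p) ^ 2) +
        2 * (a - p ^ 2 * conj a) / (1 - p * conj p) ^ 2 *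
          conj (2 * (b - p ^ 2 * conj b) / (1 - p * conj p) ^ 2)) =
      ((4 / (1 - Complex.normSq p) ^ 4 : ℝ) : ℂ) *
        ((a * conj p - p * conj a) * (b * conj p - p * conj b) +
          (a - p ^ 2 * conj a) * (conj b - conj p ^ 2 * b)) := by
    intro a b p hp
    have hp' : (1 - conj p * p : ℂ) ≠ 0 := by rwa [mul_comm]
    have e : ((1 - Complex.normSq p : ℝ) : ℂ) = 1 - p * conj p := (one_sub_normSq p).symm
    push_cast at e
    push_cast
    rw [e]
    simp only [map_div₀, map_sub, map_mul, map_one, Complex.conj_conj, map_ofNat, map_pow]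
    field_simp
    ring
  rw [key _ _ _ h, Complex.re_ofReal_mul]
  have hn : (1 - Complex.normSq (co P x)) ≠ 0 := by
    have := hlt x
    linarith
  field_simp
  simp only [Complex.normSq_apply, sq, Complex.add_re, Complex.mul_re, Complex.sub_re,
    Complex.sub_im, Complex.mul_im, Complex.conj_re, Complex.conj_im]
  ring

lemma weakInner_hForm {P A B : EndField} (hP : P ∈ paramDomain) (hA : A ∈ endSJ0)
    (hB : B ∈ endSJ0) : weakInner (psi P) (hForm P A) (hForm P B) = ∫ x, dens P A B x ∂area :=
  integral_congr_ae (Filter.Eventually.of_forall fun x => trace_raise hP hA hB x)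

lemma chartMetric_eq {P A B : EndField} (hP : P ∈ paramDomain) (hA : A ∈ endSJ0)
    (hB : B ∈ endSJ0) : chartMetric P A B = ∫ x, dens P A B x ∂area := by
  rw [chartMetric, dPsi_eq hP, dPsi_eq hP, weakInner_hForm hP hA hB]

/-! ### Integration over the sphere and definiteness of the weak metric. -/

instance : IsFiniteMeasure area := by
  unfold area
  infer_instance

instance : Measure.IsOpenPosMeasure area := by
  unfold area
  infer_instance

lemma Continuous.integrable_area {f : S2 → ℝ} (hf : Continuous f) : Integrable f area :=
  hf.integrable_of_hasCompactSupport (HasCompactSupport.of_compactSpace f)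

lemma continuous_dens {P A B : EndField} (hP : P ∈ paramDomain) (hA : A ∈ endSJ0)
    (hB : B ∈ endSJ0) : Continuous (dens P A B) := by
  have h1 := (smoothFun_re hA hB).continuous
  have h2 := (smoothFun_inv hP).continuous
  have : dens P A B = fun x => 8 * (co A x * conj (co B x)).re *
      (1 - Complex.normSq (co P x))⁻¹ ^ 2 := by
    funext x
    rw [dens, div_eq_mul_inv, inv_pow]
  rw [this]
  exact (continuous_const.mul h1).mul (h2.pow 2)

/-- The density is continuous and nonnegative, and the area measure charges every nonempty open set.
This definiteness makes a Levi-Civita connection of the merely weak metric unique. -/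
lemma eq_zero_of_integral_dens {P A : EndField} (hP : P ∈ paramDomain) (hA : A ∈ endSJ0)
    (h : ∫ x, dens P A A x ∂area = 0) : A = 0 := by
  obtain ⟨hPe, hlt⟩ := mem_paramDomain.1 hP
  have hc := continuous_dens hP hA hA
  have h0 : 0 ≤ dens P A A := by
    intro x
    rw [dens, ← normSq_eq_re]
    have := Complex.normSq_nonneg (co A x)
    positivity
  rw [integral_eq_zero_iff_of_nonneg h0 (Continuous.integrable_area hc)] at h
  have h1 := (hc.ae_eq_iff_eq area continuous_zero).1 h
  funext x
  have h2 := congrFun h1 x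
  rw [dens, ← normSq_eq_re] at h2
  have hn : (1 - Complex.normSq (co P x)) ≠ 0 := by
    have := hlt x
    linarith
  have h3 : Complex.normSq (co A x) = 0 := by
    simpa [hn] using h2
  rw [eq_anti_co hA, Complex.normSq_eq_zero.1 h3, anti_zero]
  rfl

lemma dens_comm (P A B : EndField) (x : S2) : dens P A B x = dens P B A x := by
  simp only [dens, Complex.mul_re, Complex.conj_re, Complex.conj_im]
  ring

lemma integral_dens_sub {P A B C : EndField} (hP : P ∈ paramDomain) (hA : A ∈ endSJ0)
    (hB : B ∈ endSJ0) (hC : C ∈ endSJ0) :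
    ∫ x, dens P (A - B) C x ∂area = ∫ x, dens P A C x ∂area - ∫ x, dens P B C x ∂area := by
  rw [← integral_sub (Continuous.integrable_area (continuous_dens hP hA hC))
    (Continuous.integrable_area (continuous_dens hP hB hC))]
  congr 1
  funext x
  simp only [dens, co_sub hA hB, sub_mul, Complex.sub_re]
  ring

/-! ### The Christoffel map -/

/-- The operator `(1 - P²)⁻¹ (A P B + B P A)`. -/
def gammaFun (P A B : EndField) : EndField := fun x =>
  (1 - Complex.normSq (co P x))⁻¹ • (A x * P x * B x + B x * P x * A x)

/-- The factor 2ab p̄/(1 - |p|²) is the Christoffel symbol of the Poincaré disc. The operator form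
in `gammaFun` serves for smoothness, this one for computation. -/
lemma gammaFun_apply {P A B : EndField} (hP : P ∈ paramDomain) (hA : A ∈ endSJ0)
    (hB : B ∈ endSJ0) (x : S2) : gammaFun P A B x =
      anti x (((1 - Complex.normSq (co P x))⁻¹ : ℝ) * (2 * co A x * co B x * conj (co P x))) := by
  rw [gammaFun, ← smul_anti, eq_anti_co hA, eq_anti_co hB, eq_anti_co hP.1, anti_mul_anti,
    anti_mul_anti, conf_mul_anti, conf_mul_anti, ← anti_add, co_anti (A := P) (eq_anti_co hP.1 x),
    co_anti (A := A) (eq_anti_co hA x), co_anti (A := B) (eq_anti_co hB x)]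
  congr 2
  ring

lemma gammaFun_mem {P A B : EndField} (hP : P ∈ paramDomain) (hA : A ∈ endSJ0)
    (hB : B ∈ endSJ0) : gammaFun P A B ∈ endSJ0 := by
  refine mem_endSJ0_of_anti ?_ _ (gammaFun_apply hP hA hB)
  exact (((hA.1.mul hP.1.1).mul hB.1).add ((hB.1.mul hP.1.1).mul hA.1)).smul (smoothFun_inv hP)

lemma co_gammaFun {P A B : EndField} (hP : P ∈ paramDomain) (hA : A ∈ endSJ0)
    (hB : B ∈ endSJ0) (x : S2) : co (gammaFun P A B) x =
      ((1 - Complex.normSq (co P x))⁻¹ : ℝ) * (2 * co A x * co B x * conj (co P x)) :=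
  co_anti (gammaFun_apply hP hA hB x)

lemma gammaFun_comm (P A B : EndField) : gammaFun P A B = gammaFun P B A := by
  funext x
  rw [gammaFun, gammaFun, add_comm]

lemma gammaFun_add {P A B B' : EndField} (hP : P ∈ paramDomain) (hA : A ∈ endSJ0)
    (hB : B ∈ endSJ0) (hB' : B' ∈ endSJ0) :
    gammaFun P A (B + B') = gammaFun P A B + gammaFun P A B' := by
  refine endField_ext (gammaFun_mem hP hA (add_mem hB hB'))
    (add_mem (gammaFun_mem hP hA hB) (gammaFun_mem hP hA hB')) fun x => ?_
  rw [co_gammaFun hP hA (add_mem hB hB'), co_add (gammaFun_mem hP hA hB) (gammaFun_mem hP hA hB'),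
    co_gammaFun hP hA hB, co_gammaFun hP hA hB', co_add hB hB']
  ring

lemma gammaFun_smul {P A B : EndField} (hP : P ∈ paramDomain) (hA : A ∈ endSJ0)
    (hB : B ∈ endSJ0) (c : ℝ) : gammaFun P A (c • B) = c • gammaFun P A B := by
  refine endField_ext (gammaFun_mem hP hA (endSJ0.smul_mem c hB))
    (endSJ0.smul_mem c (gammaFun_mem hP hA hB)) fun x => ?_
  rw [co_gammaFun hP hA (endSJ0.smul_mem c hB), co_smul (gammaFun_mem hP hA hB),
    co_gammaFun hP hA hB, co_smul hB]
  ring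

lemma add_gammaFun {P A A' B : EndField} (hP : P ∈ paramDomain) (hA : A ∈ endSJ0)
    (hA' : A' ∈ endSJ0) (hB : B ∈ endSJ0) :
    gammaFun P (A + A') B = gammaFun P A B + gammaFun P A' B := by
  rw [gammaFun_comm, gammaFun_add hP hB hA hA', gammaFun_comm P B, gammaFun_comm P B]

lemma smul_gammaFun {P A B : EndField} (hP : P ∈ paramDomain) (hA : A ∈ endSJ0)
    (hB : B ∈ endSJ0) (c : ℝ) : gammaFun P (c • A) B = c • gammaFun P A B := by
  rw [gammaFun_comm, gammaFun_smul hP hB hA, gammaFun_comm P B]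

open Classical in
/-- The Christoffel map of the space of associated metrics. -/
@[irreducible]
def gam (P : EndField) : endSJ0 →ₗ[ℝ] endSJ0 →ₗ[ℝ] endSJ0 :=
  if hP : P ∈ paramDomain then
    LinearMap.mk₂ ℝ (fun A B => ⟨gammaFun P A B, gammaFun_mem hP A.2 B.2⟩)
      (fun A A' B => Subtype.ext <| add_gammaFun hP A.2 A'.2 B.2)
      (fun c A B => Subtype.ext <| smul_gammaFun hP A.2 B.2 c)
      (fun A B B' => Subtype.ext <| gammaFun_add hP A.2 B.2 B'.2)
      (fun c A B => Subtype.ext <| gammaFun_smul hP A.2 B.2 c)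
  -- The value outside the domain is immaterial: `IsLeviCivita` constrains the map only on
  -- `paramDomain`.
  else 0

lemma coe_gam {P : EndField} (hP : P ∈ paramDomain) (A B : endSJ0) :
    (gam P A B : EndField) = gammaFun P A B := by
  rw [gam, dif_pos hP]
  rfl

lemma co_gam {P : EndField} (hP : P ∈ paramDomain) (A B : endSJ0) (x : S2) :
    co (gam P A B) x = ((1 - Complex.normSq (co P x))⁻¹ : ℝ) *
      (2 * co A x * co B x * conj (co P x)) := by
  rw [coe_gam hP, co_gammaFun hP A.2 B.2]

/-! ### Straight lines in the parameter domain -/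

lemma co_add_smul {P A : EndField} (hP : P ∈ endSJ0) (hA : A ∈ endSJ0) (t : ℝ) (x : S2) :
    co (P + t • A) x = co P x + t * co A x := by
  rw [co_add hP (endSJ0.smul_mem t hA), co_smul hA]

lemma normSq_add_mul (p a : ℂ) (t : ℝ) : Complex.normSq (p + t * a) =
    Complex.normSq p + t * (2 * (p * conj a).re) + t ^ 2 * Complex.normSq a := by
  simp only [Complex.normSq_apply, Complex.add_re, Complex.add_im, Complex.mul_re, Complex.mul_im,
    Complex.ofReal_re, Complex.ofReal_im, Complex.conj_re, Complex.conj_im]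
  ring

/-- Compactness of the sphere (tube lemma) makes a condition that is open jointly in t and x uniform
in x. -/
lemma eventually_forall_sphere {p : ℝ → S2 → Prop}
    (h : ∀ x, ∀ᶠ z : ℝ × S2 in nhds (0, x), p z.1 z.2) : ∀ᶠ t in nhds 0, ∀ x, p t x := by
  have := isCompact_univ.eventually_forall_of_forall_eventually (x₀ := (0 : ℝ))
    (P := fun t x => p t x) (K := (Set.univ : Set S2)) fun x _ => h x
  filter_upwards [this] with t ht x using ht x trivial

lemma continuous_normSq_line {P A : EndField} (hP : P ∈ endSJ0) (hA : A ∈ endSJ0) :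
    Continuous (fun z : ℝ × S2 => Complex.normSq (co P z.2 + z.1 * co A z.2)) := by
  simp only [normSq_add_mul]
  have h1 := (smoothFun_normSq hP).continuous
  have h2 := (smoothFun_re hP hA).continuous
  have h3 := (smoothFun_normSq hA).continuous
  exact ((h1.comp continuous_snd).add (continuous_fst.mul (continuous_const.mul
    (h2.comp continuous_snd)))).add ((continuous_fst.pow 2).mul (h3.comp continuous_snd))

/-- The domain is open along straight lines, so derivatives at t = 0 may be computed from formulas
valid only inside it. -/
lemma eventually_mem_paramDomain {P A : EndField} (hP : P ∈ paramDomain) (hA : A ∈ endSJ0) :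
    ∀ᶠ t in nhds (0 : ℝ), P + t • A ∈ paramDomain := by
  obtain ⟨hPe, hlt⟩ := mem_paramDomain.1 hP
  have h : ∀ᶠ t : ℝ in nhds 0, ∀ x, Complex.normSq (co P x + (t : ℝ) * co A x) < 1 := by
    refine eventually_forall_sphere fun x => ?_
    refine (continuous_normSq_line hPe hA).continuousAt.eventually_lt continuousAt_const ?_
    simpa using hlt x
  filter_upwards [h] with t ht
  refine mem_paramDomain.2 ⟨add_mem hPe (endSJ0.smul_mem t hA), fun x => ?_⟩
  rw [co_add_smul hPe hA]
  exact ht x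

lemma hasDerivAt_normSq_line (p a : ℂ) (t : ℝ) :
    HasDerivAt (fun t : ℝ => Complex.normSq (p + t * a))
      (2 * (p * conj a).re + 2 * t * Complex.normSq a) t := by
  simp only [normSq_add_mul]
  have h1 := ((hasDerivAt_id t).mul_const (2 * (p * conj a).re)).const_add (Complex.normSq p)
  have h2 := (hasDerivAt_pow 2 t).mul_const (Complex.normSq a)
  refine (h1.add h2).congr_deriv ?_
  simp

/-- Differentiation under the integral sign over the sphere. -/
lemma hasDerivAt_integral_sphere {F F' : ℝ → S2 → ℝ}
    (hF : ∀ᶠ t in nhds (0 : ℝ), Continuous (F t)) (hF0 : Continuous (F' 0))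
    (hF' : ∀ x, ContinuousAt (fun z : ℝ × S2 => F' z.1 z.2) (0, x))
    (hd : ∀ᶠ t in nhds (0 : ℝ), ∀ x, HasDerivAt (fun t => F t x) (F' t x) t) :
    HasDerivAt (fun t => ∫ x, F t x ∂area) (∫ x, F' 0 x ∂area) 0 := by
  obtain ⟨M, hM⟩ := isCompact_univ.exists_bound_of_continuousOn hF0.continuousOn
  -- The constant M bounds the derivative at t = 0; joint continuity and compactness preserve the
  -- bound M + 1 for nearby t. It serves as the dominating function.
  have hb : ∀ᶠ t in nhds (0 : ℝ), ∀ x, ‖F' t x‖ < M + 1 := by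
    refine eventually_forall_sphere fun x => ?_
    refine (hF' x).norm.eventually_lt continuousAt_const ?_
    have := hM x trivial
    simp only
    linarith
  have hs := hb.and hd
  refine (hasDerivAt_integral_of_dominated_loc_of_deriv_le (bound := fun _ => M + 1) hs ?_
    (Continuous.integrable_area hF.self_of_nhds) (Continuous.integrable_area hF0).1 ?_
    (integrable_const _) ?_).2
  · filter_upwards [hF] with t ht using (Continuous.integrable_area ht).1
  · exact Filter.Eventually.of_forall fun x t ht => (ht.1 x).le
  · exact Filter.Eventually.of_forall fun x t ht => ht.2 x

/-- The derivative of (1 - |p + ta|²)⁻² at 0 is 4 Re(p ā)(1 - |p|²)⁻³, and the density carries the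
constant 8. -/
lemma hasDerivAt_chartMetric {P A B C : EndField} (hP : P ∈ paramDomain) (hA : A ∈ endSJ0)
    (hB : B ∈ endSJ0) (hC : C ∈ endSJ0) :
    HasDerivAt (fun t : ℝ => chartMetric (P + t • A) B C)
      (∫ x, 32 * (co B x * conj (co C x)).re * (co P x * conj (co A x)).re *
        (1 - Complex.normSq (co P x))⁻¹ ^ 3 ∂area) 0 := by
  obtain ⟨hPe, hlt⟩ := mem_paramDomain.1 hP
  have hc1 := (smoothFun_re hB hC).continuous
  have hc2 := (smoothFun_re hPe hA).continuous
  have hc3 := (smoothFun_normSq hA).continuous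
  have hc4 := (smoothFun_inv hP).continuous
  have hev := eventually_mem_paramDomain hP hA
  let F : ℝ → S2 → ℝ := fun t x => dens (P + t • A) B C x
  let F' : ℝ → S2 → ℝ := fun t x => 16 * (co B x * conj (co C x)).re *
    (2 * (co P x * conj (co A x)).re + 2 * t * Complex.normSq (co A x)) *
      (1 - Complex.normSq (co P x + t * co A x))⁻¹ ^ 3
  have h0 : ∀ x, F' 0 x = 32 * (co B x * conj (co C x)).re * (co P x * conj (co A x)).re *
        (1 - Complex.normSq (co P x))⁻¹ ^ 3 := by
    intro x
    simp only [F', Complex.ofReal_zero, zero_mul, add_zero, mul_zero]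
    ring
  have key : HasDerivAt (fun t => ∫ x, F t x ∂area) (∫ x, F' 0 x ∂area) 0 := by
    refine hasDerivAt_integral_sphere ?_ ?_ ?_ ?_
    · filter_upwards [hev] with t ht using continuous_dens ht hB hC
    · rw [funext h0]
      exact ((continuous_const.mul hc1).mul hc2).mul (hc4.pow 3)
    · intro x
      have h1 : ContinuousAt
          (fun z : ℝ × S2 => (1 - Complex.normSq (co P z.2 + z.1 * co A z.2))⁻¹) (0, x) := by
        refine ContinuousAt.inv₀
          (continuousAt_const.sub (continuous_normSq_line hPe hA).continuousAt) ?_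
        have := hlt x
        simp only [Complex.ofReal_zero, zero_mul, add_zero]
        linarith
      have h2 : Continuous (fun z : ℝ × S2 => 16 * (co B z.2 * conj (co C z.2)).re *
          (2 * (co P z.2 * conj (co A z.2)).re + 2 * z.1 * Complex.normSq (co A z.2))) :=
        (continuous_const.mul (hc1.comp continuous_snd)).mul
          ((continuous_const.mul (hc2.comp continuous_snd)).add
            ((continuous_const.mul continuous_fst).mul (hc3.comp continuous_snd)))
      exact h2.continuousAt.mul (h1.pow 3)
    · filter_upwards [hev] with t ht x
      have hn : 1 - Complex.normSq (co P x + t * co A x) ≠ 0 := by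
        have := (mem_paramDomain.1 ht).2 x
        rw [co_add_smul hPe hA] at this
        linarith
      have h1 := ((hasDerivAt_normSq_line (co P x) (co A x) t).const_sub 1).fun_inv hn
      have h2 := (h1.fun_pow 2).const_mul (8 * (co B x * conj (co C x)).re)
      have h3 : (fun t => F t x) = fun t : ℝ => 8 * (co B x * conj (co C x)).re *
          (1 - Complex.normSq (co P x + t * co A x))⁻¹ ^ 2 := by
        funext s
        simp only [F, dens, co_add_smul hPe hA, div_eq_mul_inv, inv_pow]
      rw [h3]
      refine h2.congr_deriv ?_
      simp only [F', Nat.reduceSub, pow_one, Nat.cast_ofNat]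
      field_simp
      ring
  rw [funext h0] at key
  refine key.congr_of_eventuallyEq ?_
  filter_upwards [hev] with t ht
  exact chartMetric_eq ht hB hC

/-! ### The Levi-Civita connection -/

/-- Metric compatibility on a single disc, before integration. -/
lemma dens_gam {P : EndField} (hP : P ∈ paramDomain) (A B C : endSJ0) (x : S2) :
    dens P (gam P A B) C x + dens P B (gam P A C) x =
      32 * (co B x * conj (co C x)).re * (co P x * conj (co A x)).re *
        (1 - Complex.normSq (co P x))⁻¹ ^ 3 := by
  rw [dens, dens, co_gam hP, co_gam hP]
  simp only [map_mul, Complex.conj_ofReal, map_ofNat, Complex.conj_conj, div_eq_mul_inv, ← inv_pow]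
  generalize (1 - Complex.normSq (co P x))⁻¹ = r
  simp only [Complex.mul_re, Complex.mul_im, Complex.conj_re, Complex.conj_im, Complex.ofReal_re,
    Complex.ofReal_im, Complex.re_ofNat, Complex.im_ofNat]
  ring

lemma isLeviCivita_gam : IsLeviCivita gam := by
  refine ⟨fun P hP A B => Subtype.ext ?_, fun P hP A B C => ?_⟩
  · rw [coe_gam hP, coe_gam hP, gammaFun_comm]
  · rw [chartMetric_eq hP (gam P A B).2 C.2, chartMetric_eq hP B.2 (gam P A C).2,
      ← integral_add (Continuous.integrable_area (continuous_dens hP (gam P A B).2 C.2))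
        (Continuous.integrable_area (continuous_dens hP B.2 (gam P A C).2))]
    simp only [dens_gam hP]
    exact hasDerivAt_chartMetric hP A.2 B.2 C.2

/-- A symmetric map which is metric with respect to a nondegenerate symmetric form is determined
by the derivative of the form. -/
lemma eq_of_metric_of_symm {E : Type*} [AddCommGroup E] {G : E → E → ℝ} (hcomm : ∀ A B, G A B = G B A)
    (hsub : ∀ A B C, G (A - B) C = G A C - G B C) (hzero : ∀ A, G A A = 0 → A = 0)
    {Γ Γ' : E → E → E} (hΓ : ∀ A B, Γ A B = Γ B A) (hΓ' : ∀ A B, Γ' A B = Γ' B A)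
    (h : ∀ A B C, G (Γ A B) C + G B (Γ A C) = G (Γ' A B) C + G B (Γ' A C)) (A B : E) :
    Γ A B = Γ' A B := by
  have hanti : ∀ A B C, G (Γ A B - Γ' A B) C = -G (Γ A C - Γ' A C) B := by
    intro A B C
    have h := h A B C
    rw [hcomm B, hcomm B] at h
    rw [hsub, hsub]
    linarith
  -- The trilinear expression is symmetric in its first two arguments and antisymmetric in the last
  -- two; the usual braid of six transpositions makes it equal to its own negative.
  have key : ∀ A B C, G (Γ A B - Γ' A B) C = 0 := by
    intro A B C
    have h1 := hanti A B C
    have h2 := hanti C A B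
    have h3 := hanti B C A
    rw [hΓ A C, hΓ' A C] at h1
    rw [hΓ C B, hΓ' C B] at h2
    rw [hΓ B A, hΓ' B A] at h3
    linarith
  exact sub_eq_zero.1 (hzero _ (key A B _))

/-- The Levi-Civita connection is unique on the domain of the chart. -/
lemma IsLeviCivita.eq_gam {Γ : EndField → endSJ0 →ₗ[ℝ] endSJ0 →ₗ[ℝ] endSJ0}
    (hΓ : IsLeviCivita Γ) {P : EndField} (hP : P ∈ paramDomain) (A B : endSJ0) :
    Γ P A B = gam P A B := by
  refine eq_of_metric_of_symm (E := endSJ0) (G := fun A B => chartMetric P A B)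
    (fun A B => ?_) (fun A B C => ?_) (fun A h => ?_) (Γ := fun A B => Γ P A B)
    (Γ' := fun A B => gam P A B) (hΓ.torsion_free P hP) (isLeviCivita_gam.torsion_free P hP)
    (fun A B C => ?_) A B
  · simp only [chartMetric_eq hP A.2 B.2, chartMetric_eq hP B.2 A.2, dens_comm P A B]
  · simp only [chartMetric_eq hP (A - B).2 C.2, chartMetric_eq hP A.2 C.2, chartMetric_eq hP B.2 C.2]
    exact integral_dens_sub hP A.2 B.2 C.2
  · simp only [chartMetric_eq hP A.2 A.2] at h
    exact Subtype.ext (eq_zero_of_integral_dens hP A.2 h)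
  · exact (hΓ.metric P hP A B C).unique (isLeviCivita_gam.metric P hP A B C)

/-! ### Curvature -/

/-- The directional derivative of the Christoffel map. -/
def dgam (P A B C : EndField) : EndField := fun x =>
  (1 - Complex.normSq (co P x))⁻¹ • (B x * A x * C x + C x * A x * B x) +
    ((1 - Complex.normSq (co P x))⁻¹ * ((1 - Complex.normSq (co P x))⁻¹ *
      (2 * (co P x * conj (co A x)).re))) • (B x * P x * C x + C x * P x * B x)

lemma dgam_apply {P A B C : EndField} (hP : P ∈ paramDomain) (hA : A ∈ endSJ0)
    (hB : B ∈ endSJ0) (hC : C ∈ endSJ0) (x : S2) : dgam P A B C x =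
      anti x (((1 - Complex.normSq (co P x))⁻¹ : ℝ) * (2 * co B x * co C x * conj (co A x)) +
        (((1 - Complex.normSq (co P x))⁻¹ * ((1 - Complex.normSq (co P x))⁻¹ *
          (2 * (co P x * conj (co A x)).re)) : ℝ) : ℂ) *
            (2 * co B x * co C x * conj (co P x))) := by
  have h : ∀ b q c : ℂ, anti x b * anti x q * anti x c + anti x c * anti x q * anti x b =
      anti x (2 * b * c * conj q) := by
    intro b q c
    rw [anti_mul_anti, anti_mul_anti, conf_mul_anti, conf_mul_anti, ← anti_add]
    congr 1
    ring
  rw [dgam, anti_add, ← smul_anti, ← smul_anti, ← h, ← h, ← eq_anti_co hA, ← eq_anti_co hB,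
    ← eq_anti_co hC, ← eq_anti_co hP.1]

lemma dgam_mem {P A B C : EndField} (hP : P ∈ paramDomain) (hA : A ∈ endSJ0)
    (hB : B ∈ endSJ0) (hC : C ∈ endSJ0) : dgam P A B C ∈ endSJ0 := by
  refine mem_endSJ0_of_anti ?_ _ (dgam_apply hP hA hB hC)
  have h1 := smoothFun_inv hP
  have h2 : ∀ Q, Q ∈ endSJ0 → IsSmoothEnd (fun x => B x * Q x * C x + C x * Q x * B x) :=
    fun Q hQ => ((hB.1.mul hQ.1).mul hC.1).add ((hC.1.mul hQ.1).mul hB.1)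
  exact ((h2 A hA).smul h1).add
    ((h2 P hP.1).smul (h1.mul (h1.mul (contMDiff_const.mul (smoothFun_re hP.1 hA)))))

/-- The map `anti` as a linear map. -/
def antiL (x : S2) : ℂ →ₗ[ℝ] EndT x where
  toFun := anti x
  map_add' := anti_add
  map_smul' c z := by
    rw [Complex.real_smul, ← smul_anti]
    rfl

lemma hasDerivAt_anti {x : S2} {f : ℝ → ℂ} {f' : ℂ} {t : ℝ} (hf : HasDerivAt f f' t) :
    HasDerivAt (fun t => anti x (f t)) (anti x f') t :=
  hasDerivAt_linearMap_comp (E := ℂ) (F := EndT x) (antiL x) hf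

/-- Any Levi-Civita map agrees with `gam` near t = 0 on the line, so the explicit formula can be
differentiated at each point. -/
lemma hasDirDeriv_gam {Γ : EndField → endSJ0 →ₗ[ℝ] endSJ0 →ₗ[ℝ] endSJ0}
    (hΓ : IsLeviCivita Γ) {P : EndField} (hP : P ∈ paramDomain) (A B C : endSJ0) :
    HasDirDeriv (fun Q => Γ Q B C) P A ⟨dgam P A B C, dgam_mem hP A.2 B.2 C.2⟩ := by
  intro x
  have hn : 1 - Complex.normSq (co P x + (0 : ℝ) * co A x) ≠ 0 := by
    have := (mem_paramDomain.1 hP).2 x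
    simp only [Complex.ofReal_zero, zero_mul, add_zero]
    linarith
  have h1 := ((hasDerivAt_normSq_line (co P x) (co A x) 0).const_sub 1).fun_inv hn
  have h2 : HasDerivAt (fun t : ℝ => 2 * co B x * co C x * (conj (co P x) + t * conj (co A x)))
      (2 * co B x * co C x * conj (co A x)) 0 := by
    have h3 : HasDerivAt (fun t : ℝ => (t : ℂ)) 1 0 := Complex.ofRealCLM.hasDerivAt
    refine (((h3.mul_const (conj (co A x))).const_add (conj (co P x))).const_mul
      (2 * co B x * co C x)).congr_deriv ?_
    rw [one_mul]
  have h4 := h1.ofReal_comp.mul h2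
  have h5 := hasDerivAt_anti (x := x) h4
  refine HasDerivAt.congr_deriv (𝕜 := ℝ) (F := EndT x)
    (h5.congr_of_eventuallyEq (f₁ := fun t : ℝ => (Γ (P + t • (A : EndField)) B C : EndField) x)
      ?_) ?_
  · filter_upwards [eventually_mem_paramDomain hP A.2] with t ht
    rw [hΓ.eq_gam ht, coe_gam ht, gammaFun_apply ht B.2 C.2, co_add_smul hP.1 A.2,
      map_add (starRingEnd ℂ), map_mul (starRingEnd ℂ), Complex.conj_ofReal]
    rfl
  change _ = dgam P A B C x
  rw [dgam_apply hP A.2 B.2 C.2]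
  congr 1
  simp only [Complex.ofReal_zero, zero_mul, add_zero, mul_zero]
  push_cast
  field_simp
  ring

lemma HasDirDeriv.unique {F : EndField → endSJ0} {P : EndField} {A D D' : endSJ0}
    (h : HasDirDeriv F P A D) (h' : HasDirDeriv F P A D') : D = D' := by
  refine Subtype.ext (funext fun x => ?_)
  exact HasDerivAt.unique (𝕜 := ℝ) (F := T x →L[ℝ] T x) (h x) (h' x)

/-- The quadratic Christoffel terms cancel, as do the p̄² parts left after expanding 2 Re(p ā) = p ā
+ p̄ a. What remains is 2sb(b ā - a b̄)(1 + s|p|²), and 1 + s|p|² = s. -/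
lemma curvature_identity {p : ℂ} (hp : Complex.normSq p < 1) (a b : ℂ) {s : ℝ}
    (hs : s = (1 - Complex.normSq p)⁻¹) :
    ((s : ℂ) * (2 * b * b * conj a) + (s * (s * (2 * (p * conj a).re)) : ℝ) * (2 * b * b * conj p) +
      s * (2 * a * (s * (2 * b * b * conj p)) * conj p)) -
    (s * (2 * a * b * conj b) + (s * (s * (2 * (p * conj b).re)) : ℝ) * (2 * a * b * conj p) +
      s * (2 * b * (s * (2 * a * b * conj p)) * conj p)) =
    (s ^ 2 : ℝ) * (2 * b * (b * conj a - a * conj b)) := by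
  have hs' : (s : ℂ) * (1 - p * conj p) = 1 := by
    rw [one_sub_normSq, ← Complex.ofReal_mul, hs, inv_mul_cancel₀ (sub_pos.2 hp).ne',
      Complex.ofReal_one]
  have e : ∀ a : ℂ, (((p * conj a).re : ℝ) : ℂ) = (p * conj a + conj p * a) / 2 := by
    intro a
    rw [Complex.re_eq_add_conj, map_mul, Complex.conj_conj]
  rw [Complex.ofReal_mul, Complex.ofReal_mul, Complex.ofReal_mul, e, Complex.ofReal_mul,
    Complex.ofReal_mul, Complex.ofReal_mul, e, Complex.ofReal_pow, Complex.ofReal_ofNat]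
  linear_combination -(s * 2 * b * (b * conj a - a * conj b)) * hs'

/-- The curvature tensor in coordinates. -/
lemma IsCurvature.co_eq {Γ : EndField → endSJ0 →ₗ[ℝ] endSJ0 →ₗ[ℝ] endSJ0}
    (hΓ : IsLeviCivita Γ) {P : EndField} (hP : P ∈ paramDomain) {A B R : endSJ0}
    (h : IsCurvature Γ P A B B R) (x : S2) : co R x =
      ((1 - Complex.normSq (co P x))⁻¹ ^ 2 : ℝ) *
        (2 * co B x * (co B x * conj (co A x) - co A x * conj (co B x))) := by
  obtain ⟨D₁, D₂, h1, h2, hR⟩ := h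
  have c1 := (congrArg (fun D : endSJ0 => co (D : EndField) x)
    (h1.unique (hasDirDeriv_gam hΓ hP A B B))).trans (co_anti (dgam_apply hP A.2 B.2 B.2 x))
  have c2 := (congrArg (fun D : endSJ0 => co (D : EndField) x)
    (h2.unique (hasDirDeriv_gam hΓ hP B A B))).trans (co_anti (dgam_apply hP B.2 A.2 B.2 x))
  have c3 : ∀ X Y : endSJ0, co (Γ P X Y : EndField) x =
      ((1 - Complex.normSq (co P x))⁻¹ : ℝ) * (2 * co X x * co Y x * conj (co P x)) := fun X Y => by
    rw [hΓ.eq_gam hP X Y, co_gam hP X Y x]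
  have c4 := c3 A (Γ P B B)
  rw [c3 B B] at c4
  have c5 := c3 B (Γ P A B)
  rw [c3 A B] at c5
  generalize Γ P A (Γ P B B) = X at hR c4
  generalize Γ P B (Γ P A B) = Y at hR c5
  have c6 : co R x = (co D₁ x + co X x) - (co D₂ x + co Y x) := by
    rw [hR, ← co_add D₁.2 X.2, ← co_add D₂.2 Y.2]
    exact co_sub (D₁ + X).2 (D₂ + Y).2 x
  rw [c6]
  refine (congrArg₂ (· - ·) (congrArg₂ (· + ·) c1 c4) (congrArg₂ (· + ·) c2 c5)).trans ?_
  exact curvature_identity ((mem_paramDomain.1 hP).2 x) _ _ rfl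

lemma exists_isCurvature {P : EndField} (hP : P ∈ paramDomain) (A B C : endSJ0) :
    ∃ R, IsCurvature gam P A B C R :=
  ⟨_, _, _, hasDirDeriv_gam isLeviCivita_gam hP A B C,
    hasDirDeriv_gam isLeviCivita_gam hP B A C, rfl⟩

/-- Here b ā - a b̄ = -2i Im(a b̄), so pairing with a squares the imaginary part; the constant is 8
· 2 · (-2). -/
lemma dens_curvature {Γ : EndField → endSJ0 →ₗ[ℝ] endSJ0 →ₗ[ℝ] endSJ0}
    (hΓ : IsLeviCivita Γ) {P : EndField} (hP : P ∈ paramDomain) {A B R : endSJ0}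
    (h : IsCurvature Γ P A B B R) (x : S2) : dens P R A x =
      -32 * ((co A x * conj (co B x)).im ^ 2 / (1 - Complex.normSq (co P x)) ^ 4) := by
  rw [dens, h.co_eq hΓ hP, div_eq_mul_inv, div_eq_mul_inv, ← inv_pow, ← inv_pow]
  generalize (1 - Complex.normSq (co P x))⁻¹ = r
  rw [mul_assoc ((r ^ 2 : ℝ) : ℂ), Complex.re_ofReal_mul]
  simp only [Complex.mul_re, Complex.mul_im, Complex.sub_re, Complex.sub_im, Complex.conj_re,
    Complex.conj_im, Complex.re_ofNat, Complex.im_ofNat]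
  ring

/-- The sectional curvature, in terms of complex factors. -/
def curv (P A B : EndField) : ℝ := -(1 / 2) *
  ((∫ x, (co A x * conj (co B x)).im ^ 2 / (1 - Complex.normSq (co P x)) ^ 4 ∂area) /
    ((∫ x, Complex.normSq (co A x) / (1 - Complex.normSq (co P x)) ^ 2 ∂area) *
      (∫ x, Complex.normSq (co B x) / (1 - Complex.normSq (co P x)) ^ 2 ∂area) -
    (∫ x, (conj (co A x) * co B x).re / (1 - Complex.normSq (co P x)) ^ 2 ∂area) ^ 2))

lemma integral_dens_self (P A : EndField) : ∫ x, dens P A A x ∂area =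
    8 * ∫ x, Complex.normSq (co A x) / (1 - Complex.normSq (co P x)) ^ 2 ∂area := by
  rw [← integral_const_mul]
  congr 1
  funext x
  rw [dens, ← normSq_eq_re, mul_div_assoc]

lemma integral_dens (P A B : EndField) : ∫ x, dens P A B x ∂area =
    8 * ∫ x, (conj (co A x) * co B x).re / (1 - Complex.normSq (co P x)) ^ 2 ∂area := by
  rw [← integral_const_mul]
  congr 1
  funext x
  rw [dens, mul_div_assoc]
  congr 2
  simp only [Complex.mul_re, Complex.conj_re, Complex.conj_im]
  ring

lemma sectional_eq {Γ : EndField → endSJ0 →ₗ[ℝ] endSJ0 →ₗ[ℝ] endSJ0}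
    (hΓ : IsLeviCivita Γ) {P : EndField} (hP : P ∈ paramDomain) {A B R : endSJ0}
    (h : IsCurvature Γ P A B B R) :
    weakInner (psi P) (dPsi P R) (hForm P A) /
      (weakInner (psi P) (hForm P A) (hForm P A) * weakInner (psi P) (hForm P B) (hForm P B) -
        weakInner (psi P) (hForm P A) (hForm P B) ^ 2) = curv P A B := by
  rw [dPsi_eq hP, weakInner_hForm hP R.2 A.2, weakInner_hForm hP A.2 A.2,
    weakInner_hForm hP B.2 B.2, weakInner_hForm hP A.2 B.2, integral_dens_self, integral_dens_self,
    integral_dens P A B]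
  simp only [dens_curvature hΓ hP h]
  rw [integral_const_mul, curv]
  generalize (∫ x, Complex.normSq (co (A : EndField) x) / _ ∂area) = a
  generalize (∫ x, Complex.normSq (co (B : EndField) x) / _ ∂area) = b
  generalize (∫ x, (conj (co (A : EndField) x) * co (B : EndField) x).re / _ ∂area) = c
  generalize (∫ x, (co (A : EndField) x * conj (co (B : EndField) x)).im ^ 2 / _ ∂area) = n
  have : 8 * a * (8 * b) - (8 * c) ^ 2 = 64 * (a * b - c ^ 2) := by ring
  rw [this, mul_div_mul_comm]
  norm_num

/-- The existential choices in the definition have no effect on K: P, A, B are fixed by injectivity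
of `psi` and `hForm P`, the Christoffel map by uniqueness on the domain, and the derivatives by
uniqueness of limits. -/
lemma hasSectionalCurvature_iff {P A B : EndField} (hP : P ∈ paramDomain) (hA : A ∈ endSJ0)
    (hB : B ∈ endSJ0) (hli : LinearIndependent ℝ ![hForm P A, hForm P B]) (K : ℝ) :
    HasSectionalCurvature (psi P) (hForm P A) (hForm P B) K ↔ K = curv P A B := by
  constructor
  · rintro ⟨-, -, -, -, Q, hQ, A', B', hQP, hA', hB', Γ, hΓ, R, hR, rfl⟩
    obtain rfl := psi_injOn hQ hP hQP
    rw [dPsi_eq hP] at hA' hB'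
    obtain rfl := hForm_injOn hP A'.2 hA hA'
    obtain rfl := hForm_injOn hP B'.2 hB hB'
    exact sectional_eq hΓ hP hR
  · rintro rfl
    obtain ⟨R, hR⟩ := exists_isCurvature hP ⟨A, hA⟩ ⟨B, hB⟩ ⟨B, hB⟩
    exact ⟨psi_mem_AM hP, hForm_mem_tangentAM hP hA, hForm_mem_tangentAM hP hB, hli, P, hP,
      ⟨A, hA⟩, ⟨B, hB⟩, rfl, dPsi_eq hP A, dPsi_eq hP B, gam, isLeviCivita_gam, R, hR,
      (sectional_eq isLeviCivita_gam hP hR).symm⟩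

/-! ### Complex functions and integrals over the sphere without poles -/

lemma IsGivenBy.eq {A : EndField} {α : S2 → ℂ} (hA : A ∈ endSJ0) (h : IsGivenBy A α) {x : S2}
    (hx : x ∈ offPoles) : α x = conj (co A x) := by
  let f : T x →ₗ[ℝ] ℝ := (innerSL ℝ (e1 x) : T x →L[ℝ] ℝ)
  -- The complex-linear extension of the e₁-component. Applied to A∂ = α∂̄ it gives ½(Re a - i Im a)
  -- = ½α, whence the conjugate.
  let F : ℂ ⊗[ℝ] T x →ₗ[ℂ] ℂ := (TensorProduct.AlgebraTensorModule.rid ℝ ℂ ℂ).toLinearMap ∘ₗ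
    f.baseChange ℂ
  have hF : ∀ (z : ℂ) (u : T x), F (z ⊗ₜ[ℝ] u) = (⟪e1 x, u⟫_ℝ : ℂ) * z := by
    intro z u
    simp [F, f]
  have h1 := congrArg F (h x hx).1
  have hA1 : A x (e1 x) = (co A x).re • e1 x + (co A x).im • J0 x (e1 x) := by
    rw [← frame_eq hx, ← anti_frame, ← eq_anti_co hA]
  have hA2 : A x (e2 x) = (co A x).im • e1 x - (co A x).re • J0 x (e1 x) := by
    rw [e2, hA.2.2, hA1, map_add, map_smul, map_smul, J0_J0_apply]
    module
  have i1 := inner_e1_self hx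
  have i2 : ⟪e1 x, J0 x (e1 x)⟫_ℝ = 0 := inner_J0_self x _
  simp only [del, delBar, map_smul, map_sub, map_add, LinearMap.baseChange_tmul, hF,
    ContinuousLinearMap.coe_coe, hA1, hA2, inner_add_right, inner_sub_right, inner_smul_right,
    i1, i2, smul_eq_mul] at h1
  rw [e2, i2] at h1
  apply Complex.ext
  · have := congrArg Complex.re h1
    simp at this ⊢
    linarith
  · have := congrArg Complex.im h1
    simp at this ⊢
    linarith

/-- The measure of a set on the sphere is a multiple of the volume of the cone over it, and the cone
over the poles lies in the plane where the first coordinate vanishes. -/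
lemma ae_mem_offPoles : ∀ᵐ x ∂area, x ∈ offPoles := by
  have hm : MeasurableSet {x : S2 | x ∉ offPoles} := by
    have : IsClosed {x : S2 | 1 ≤ |(x : E3) 2|} := isClosed_le continuous_const (by fun_prop)
    simpa [offPoles] using this.measurableSet
  rw [ae_iff, area, Measure.toSphere_apply' _ hm]
  let V : Submodule ℝ E3 := LinearMap.ker (EuclideanSpace.proj (𝕜 := ℝ) (0 : Fin 3) : E3 →L[ℝ] ℝ).toLinearMap
  have hV : (volume : Measure E3) V = 0 := by
    refine Measure.addHaar_submodule _ V fun h => ?_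
    have h1 : EuclideanSpace.single (0 : Fin 3) (1 : ℝ) ∈ V := h ▸ Submodule.mem_top
    simp [V] at h1
  refine mul_eq_zero_of_right _ (measure_mono_null ?_ hV)
  rintro _ ⟨r, -, _, ⟨x, hx, rfl⟩, rfl⟩
  have h1 := sum_sq x
  have h2 : 1 ≤ (x : E3) 2 ^ 2 := (one_le_sq_iff_one_le_abs _).2 (not_lt.1 hx)
  have h3 : (x : E3) 0 = 0 := by nlinarith [sq_nonneg ((x : E3) 0), sq_nonneg ((x : E3) 1)]
  simp [V, h3]

lemma area_real_univ : area.real Set.univ = 4 * Real.pi := by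
  rw [area, Measure.toSphere_real_apply_univ, Measure.real, EuclideanSpace.volume_ball_fin_three]
  simp
  have := Real.pi_pos
  rw [ENNReal.toReal_ofReal (by positivity)]
  ring

lemma curv_eq {P A B : EndField} (hP : P ∈ endSJ0) (hA : A ∈ endSJ0) (hB : B ∈ endSJ0)
    {p α β : S2 → ℂ} (hp : IsGivenBy P p) (hα : IsGivenBy A α) (hβ : IsGivenBy B β) :
    curv P A B = -(1 / 2) *
      ((∫ x, (α x * conj (β x)).im ^ 2 / (1 - ‖p x‖ ^ 2) ^ 4 ∂area) /
        ((∫ x, ‖α x‖ ^ 2 / (1 - ‖p x‖ ^ 2) ^ 2 ∂area) *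
          (∫ x, ‖β x‖ ^ 2 / (1 - ‖p x‖ ^ 2) ^ 2 ∂area) -
        (∫ x, (conj (α x) * β x).re / (1 - ‖p x‖ ^ 2) ^ 2 ∂area) ^ 2)) := by
  have h : ∀ᵐ x ∂area, p x = conj (co P x) ∧ α x = conj (co A x) ∧ β x = conj (co B x) :=
    ae_mem_offPoles.mono fun x hx => ⟨hp.eq hP hx, hα.eq hA hx, hβ.eq hB hx⟩
  have i1 : ∀ {a q : S2 → ℂ} {C Q : EndField}, (∀ᵐ x ∂area, q x = conj (co Q x) ∧
      a x = conj (co C x)) → ∫ x, Complex.normSq (co C x) / (1 - Complex.normSq (co Q x)) ^ 2 ∂area =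
        ∫ x, ‖a x‖ ^ 2 / (1 - ‖q x‖ ^ 2) ^ 2 ∂area := fun h =>
    integral_congr_ae (h.mono fun x ⟨h1, h2⟩ => by
      simp only [h1, h2, ← Complex.normSq_eq_norm_sq, Complex.normSq_conj])
  have i2 : ∫ x, (co A x * conj (co B x)).im ^ 2 / (1 - Complex.normSq (co P x)) ^ 4 ∂area =
      ∫ x, (α x * conj (β x)).im ^ 2 / (1 - ‖p x‖ ^ 2) ^ 4 ∂area := by
    refine integral_congr_ae (h.mono fun x ⟨h1, h2, h3⟩ => ?_)
    simp only [h1, h2, h3, ← Complex.normSq_eq_norm_sq, Complex.normSq_conj]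
    congr 1
    simp only [Complex.mul_im, Complex.conj_re, Complex.conj_im]
    ring
  have i3 : ∫ x, (conj (co A x) * co B x).re / (1 - Complex.normSq (co P x)) ^ 2 ∂area =
      ∫ x, (conj (α x) * β x).re / (1 - ‖p x‖ ^ 2) ^ 2 ∂area := by
    refine integral_congr_ae (h.mono fun x ⟨h1, h2, h3⟩ => ?_)
    simp only [h1, h2, h3, ← Complex.normSq_eq_norm_sq, Complex.normSq_conj]
    congr 1
    simp only [Complex.mul_re, Complex.conj_re, Complex.conj_im]
    ring
  rw [curv, i1 (h.mono fun x hx => ⟨hx.1, hx.2.1⟩), i1 (h.mono fun x hx => ⟨hx.1, hx.2.2⟩), i2, i3]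

/-! ### The holomorphic sectional curvature -/

/-- The operator `A J₀`. -/
def rot (A : EndField) : EndField := fun x => A x * J0 x

lemma rot_apply {A : EndField} (hA : A ∈ endSJ0) (x : S2) :
    rot A x = anti x (-Complex.I * co A x) := by
  rw [rot, eq_anti_co hA, ← conf_I, anti_mul_conf, Complex.conj_I, mul_comm]

lemma rot_mem {A : EndField} (hA : A ∈ endSJ0) : rot A ∈ endSJ0 :=
  mem_endSJ0_of_anti (hA.1.mul isSmoothEnd_J0) _ (rot_apply hA)

lemma co_rot {A : EndField} (hA : A ∈ endSJ0) (x : S2) : co (rot A) x = -Complex.I * co A x :=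
  co_anti (rot_apply hA x)

/-- Since P anticommutes with J₀, (1 - P)⁻¹ J₀ (1 + P) = J₀. Thus composing h_A with J = J₀ S
amounts to replacing A by A J₀. -/
lemma bigJ_hForm {P A J : EndField} (hP : P ∈ paramDomain) (hA : A ∈ endSJ0)
    (hJ : IsMetricOf (psi P) J) : bigJ J (hForm P A) = hForm P (rot A) := by
  obtain rfl := metric_unique hJ (isMetricOf_psi P)
  obtain ⟨hPe, hlt⟩ := mem_paramDomain.1 hP
  funext x
  have hD := one_sub_ne_zero (hlt x)
  have key : hOp P A x * (J0 x * cayley P x) = hOp P (rot A) x := by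
    rw [hOp_apply hP hA, hOp_apply hP (rot_mem hA), cayley_apply hP, J0_eq_ca, ca_mul, ca_mul,
      co_rot hA]
    have hD' : (1 - conj (co P x) * co P x) ≠ 0 := by rwa [mul_comm]
    apply ca_congr <;>
    · simp only [map_zero, map_div₀, map_add, map_sub, map_mul, map_one, Complex.conj_conj,
        map_ofNat, map_neg, Complex.conj_I]
      field_simp
      ring
  ext u v
  rw [hForm_eq P (rot A), ← key, g0Form_apply, mul_apply_eq_comp, ← g0Form_apply, ← hForm_eq]
  rfl

lemma hForm_add_smul {P A B : EndField} (r s : ℝ) :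
    hForm P (r • A + s • B) = r • hForm P A + s • hForm P B := by
  funext x
  ext u v
  simp only [hForm_eq, g0Form_apply, hOp, Pi.add_apply, Pi.smul_apply, add_apply, smul_apply,
    mul_apply_eq_comp, map_add, map_smul, inner_add_right, inner_smul_right, smul_eq_mul]
  ring

lemma linearIndependent_rot {P A : EndField} (hP : P ∈ paramDomain) (hA : A ∈ endSJ0)
    (hA0 : A ≠ 0) : LinearIndependent ℝ ![hForm P A, hForm P (rot A)] := by
  refine (@LinearIndependent.pair_iffₛ ℝ FormField _ _ _ _ _).2 fun r s r' s' h => ?_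
  rw [← hForm_add_smul, ← hForm_add_smul] at h
  have hm : ∀ a b : ℝ, a • A + b • rot A ∈ endSJ0 := fun a b =>
    endSJ0.add_mem (endSJ0.smul_mem a hA) (endSJ0.smul_mem b (rot_mem hA))
  have h1 := hForm_injOn hP (hm r s) (hm r' s') h
  by_contra hrs
  refine hA0 (endField_ext hA endSJ0.zero_mem fun x => ?_)
  have hz : co 0 x = 0 := co_anti (by rw [anti_zero]; rfl)
  -- A real combination of A and A J₀ is multiplication of the factor by one complex number, which
  -- can be cancelled wherever A does not vanish.
  have hc : ∀ a b : ℝ, co (a • A + b • rot A) x = (a - b * Complex.I) * co A x := fun a b => by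
    rw [co_add (endSJ0.smul_mem a hA) (endSJ0.smul_mem b (rot_mem hA)), co_smul hA,
      co_smul (rot_mem hA), co_rot hA]
    ring
  have h2 := congrArg (fun D => co D x) h1
  simp only [hc] at h2
  rw [hz]
  by_contra h3
  have h4 := mul_right_cancel₀ h3 h2
  have h5 := congrArg Complex.re h4
  have h6 := congrArg Complex.im h4
  simp at h5 h6
  exact hrs ⟨h5, h6⟩

/-- Cauchy–Schwarz against the constant 1, obtained by expanding ∫(4πf - ∫f)² ≥ 0 with total area
4π. -/
lemma sq_integral_le {f : S2 → ℝ} (hf : Continuous f) :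
    (∫ x, f x ∂area) ^ 2 ≤ 4 * Real.pi * ∫ x, f x ^ 2 ∂area := by
  have hpi := Real.pi_pos
  have h0 : 0 ≤ ∫ x, (4 * Real.pi * f x - ∫ y, f y ∂area) ^ 2 ∂area :=
    integral_nonneg fun x => sq_nonneg _
  set c := ∫ y, f y ∂area with hc
  have h1 : ∀ x, (4 * Real.pi * f x - c) ^ 2 =
      ((4 * Real.pi) ^ 2 * f x ^ 2 - (8 * Real.pi * c) * f x) + c ^ 2 := fun x => by ring
  simp only [h1] at h0
  have i1 : Integrable (fun x => (4 * Real.pi) ^ 2 * f x ^ 2) area :=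
    Continuous.integrable_area (continuous_const.mul (hf.pow 2))
  have i2 : Integrable (fun x => (8 * Real.pi * c) * f x) area :=
    Continuous.integrable_area (continuous_const.mul hf)
  have i3 : Integrable (fun x => (4 * Real.pi) ^ 2 * f x ^ 2 - (8 * Real.pi * c) * f x) area :=
    i1.sub i2
  rw [integral_add i3 (integrable_const _), integral_sub i1 i2, integral_const_mul,
    integral_const_mul, integral_const, area_real_univ, ← hc, smul_eq_mul] at h0
  nlinarith

lemma curv_rot_le {P A : EndField} (hP : P ∈ paramDomain) (hA : A ∈ endSJ0) (hA0 : A ≠ 0) :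
    curv P A (rot A) ≤ -(1 / (8 * Real.pi)) := by
  have hpi := Real.pi_pos
  let f : S2 → ℝ := fun x => Complex.normSq (co A x) / (1 - Complex.normSq (co P x)) ^ 2
  have hf : Continuous f := by
    have h := (continuous_dens hP hA hA).div_const 8
    refine h.congr fun x => ?_
    rw [dens, ← normSq_eq_re, mul_div_assoc, mul_div_cancel_left₀ _ (by norm_num)]
  have hne : ∫ x, f x ∂area ≠ 0 := fun h => hA0 <| eq_zero_of_integral_dens hP hA <| by
    rw [integral_dens_self, h, mul_zero]
  have e1 : ∀ x, (co A x * conj (co (rot A) x)).im ^ 2 / (1 - Complex.normSq (co P x)) ^ 4 =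
      f x ^ 2 := by
    intro x
    rw [co_rot hA, div_pow, ← pow_mul]
    congr 2
    simp [Complex.normSq_apply]
  have e2 : ∀ x, Complex.normSq (co (rot A) x) = Complex.normSq (co A x) := by
    intro x
    rw [co_rot hA, map_mul, Complex.normSq_neg, Complex.normSq_I, one_mul]
  have e3 : ∀ x, (conj (co A x) * co (rot A) x).re = 0 := by
    intro x
    rw [co_rot hA]
    simp
    ring
  simp only [curv, e1, e2, e3, zero_div, integral_zero]
  have hcs := sq_integral_le hf
  change -(1 / 2) * ((∫ x, f x ^ 2 ∂area) / ((∫ x, f x ∂area) * (∫ x, f x ∂area) - 0 ^ 2)) ≤ _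
  have hpos : 0 < (∫ x, f x ∂area) ^ 2 := by positivity
  have : 1 / (4 * Real.pi) ≤
      (∫ x, f x ^ 2 ∂area) / ((∫ x, f x ∂area) * (∫ x, f x ∂area) - 0 ^ 2) := by
    rw [← sq, zero_pow two_ne_zero, sub_zero, div_le_div_iff₀ (by positivity) hpos]
    linarith
  have e : 1 / (8 * Real.pi) = 1 / 2 * (1 / (4 * Real.pi)) := by
    field_simp
    norm_num
  rw [e]
  linarith

end SphereAM

end

theorem theorem8p1 :
    -- `psi` is a global parametrization of the space of associated metrics,
    -- and `A ↦ h_A` is its differential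
    Set.BijOn psi paramDomain AM ∧
    (∀ P ∈ paramDomain,
      Set.BijOn (dPsi P) (endSJ0 : Set EndField) (tangentAM (psi P)) ∧
      ∀ A ∈ endSJ0, dPsi P A = hForm P A) ∧
    -- the formula for the sectional curvature, and its special cases
    (∀ P ∈ paramDomain, ∀ A ∈ endSJ0, ∀ B ∈ endSJ0, ∀ p α β : S2 → ℂ,
      IsGivenBy P p → IsGivenBy A α → IsGivenBy B β →
      LinearIndependent ℝ ![hForm P A, hForm P B] →
      (∀ K : ℝ, HasSectionalCurvature (psi P) (hForm P A) (hForm P B) K ↔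
        K = -(1 / 2) *
          ((∫ x, (α x * conj (β x)).im ^ 2 / (1 - ‖p x‖ ^ 2) ^ 4 ∂area) /
            ((∫ x, ‖α x‖ ^ 2 / (1 - ‖p x‖ ^ 2) ^ 2 ∂area) *
                (∫ x, ‖β x‖ ^ 2 / (1 - ‖p x‖ ^ 2) ^ 2 ∂area) -
              (∫ x, (conj (α x) * β x).re / (1 - ‖p x‖ ^ 2) ^ 2 ∂area) ^ 2))) ∧
      ((IsRealFun α ∧ IsRealFun β) ∨ (IsImagFun α ∧ IsImagFun β) →
        HasSectionalCurvature (psi P) (hForm P A) (hForm P B) 0) ∧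
      ((IsRealFun α ∧ IsImagFun β) ∨ (IsImagFun α ∧ IsRealFun β) →
        HasSectionalCurvature (psi P) (hForm P A) (hForm P B)
          (-(1 / 2) *
            ((∫ x, (α x * β x).im ^ 2 / (1 - ‖p x‖ ^ 2) ^ 4 ∂area) /
              ((∫ x, ‖α x‖ ^ 2 / (1 - ‖p x‖ ^ 2) ^ 2 ∂area) *
                (∫ x, ‖β x‖ ^ 2 / (1 - ‖p x‖ ^ 2) ^ 2 ∂area)))))) ∧
    -- the holomorphic sectional curvature
    (∀ P ∈ paramDomain, ∀ A ∈ endSJ0, A ≠ 0 →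
      ∀ J : EndField, IsAssociatedACS J → IsMetricOf (psi P) J →
        (∃ K : ℝ, HasSectionalCurvature (psi P) (hForm P A) (bigJ J (hForm P A)) K) ∧
        ∀ K : ℝ, HasSectionalCurvature (psi P) (hForm P A) (bigJ J (hForm P A)) K →
          K ≤ -(1 / (8 * Real.pi))) := by
  refine ⟨psi_bijOn, fun P hP => ⟨dPsi_bijOn hP, fun A _ => dPsi_eq hP A⟩, ?_, ?_⟩
  · intro P hP A hA B hB p α β hp hα hβ hli
    have key := hasSectionalCurvature_iff hP hA hB hli
    refine ⟨fun K => by rw [key, curv_eq hP.1 hA hB hp hα hβ], fun h => ?_, fun h => ?_⟩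
    · rw [key, curv_eq hP.1 hA hB hp hα hβ, integral_eq_zero_of_ae, zero_div, mul_zero]
      refine ae_mem_offPoles.mono fun x hx => ?_
      rcases h with ⟨h1, h2⟩ | ⟨h1, h2⟩ <;> simp [h1 x hx, h2 x hx]
    · rw [key, curv_eq hP.1 hA hB hp hα hβ]
      have h1 : ∫ x, (conj (α x) * β x).re / (1 - ‖p x‖ ^ 2) ^ 2 ∂area = 0 := by
        refine integral_eq_zero_of_ae (ae_mem_offPoles.mono fun x hx => ?_)
        rcases h with ⟨h1, h2⟩ | ⟨h1, h2⟩ <;> simp [h1 x hx, h2 x hx]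
      have h2 : ∫ x, (α x * conj (β x)).im ^ 2 / (1 - ‖p x‖ ^ 2) ^ 4 ∂area =
          ∫ x, (α x * β x).im ^ 2 / (1 - ‖p x‖ ^ 2) ^ 4 ∂area := by
        refine integral_congr_ae (ae_mem_offPoles.mono fun x hx => ?_)
        rcases h with ⟨h1, h2⟩ | ⟨h1, h2⟩ <;> simp [h1 x hx, h2 x hx]
      rw [h1, h2, zero_pow two_ne_zero, sub_zero]
  · intro P hP A hA hA0 J _ hJ
    -- The plane is thereby spanned by two forms h_A and h_B with B = A J₀, to which the general
    -- formula applies.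
    rw [bigJ_hForm hP hA hJ]
    have key := hasSectionalCurvature_iff hP hA (rot_mem hA) (linearIndependent_rot hP hA hA0)
    exact ⟨⟨_, (key _).2 rfl⟩, fun K hK => (key K).1 hK ▸ curv_rot_le hP hA hA0⟩
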